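/- Let $n\ge 1$ and $d$ be natural numbers and let $\|\cdot\|$ be the Euclidean norm. A dataset $Z=(z_1,\dots,z_n)$ (where $z_i=-y_ix_i$ for examples $x_i\in\mathbb R^d$ with labels $y_i\in\{-1,+1\}$) satisfies $\|z_i\|\le 1$ for all $i$; it is linearly separable if $\langle u,-z_i\rangle>0$ for all $i$, for some $u\in\mathbb R^d$. Let $\mathcal R(w)=\frac1n\sum_{i=1}^n e^{\langle w,z_i\rangle}$ be the risk for the exponential loss. Given steps $\eta_t\in\mathbb R$, gradient descent is $w_0=0$, $w_{t+1}=w_t-\eta_t\nabla\mathcal R(w_t)$; put $\hat\eta_t=\eta_t\mathcal R(w_t)$. Call the steps admissible if $\hat\eta_t\le 1$ for all $t$, $(\hat\eta_t)_t$ is nonincreasing, and $\sum_{j}\eta_j=\infty$. Let $\bar u$ be the maximum margin direction, i.e. the maximizer of $\min_i\langle u,-z_i\rangle$ over $\|u\|=1$, and $\gamma$ the maximum. Let $S=\{i:\langle\bar u,-z_i\rangle=\gamma\}$ and $\gamma'=\min_{i\notin S}\langle\bar u,-z_i\rangle-\gamma\in(0,\infty]$ ($\gamma'=\infty$ if $S$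 contains all indices). With $z_{i,\perp}=z_i-\langle z_i,\bar u\rangle\bar u$, let $\bar v$ be the minimizer of $\mathcal R_\perp(w)=\frac1n\sum_{i\in S}e^{\langle w,z_{i,\perp}\rangle}$ over $\mathrm{span}\{z_{i,\perp}:i\in S\}$. **Upper bounds.** There is a real-valued function $C(\cdot,\cdot,\cdot)$, independent of everything else (in particular of $n$, $d$, the steps and $t$), such that the following holds for all $n\ge1$ and $d$. Let $(z_1,\dots,z_n)$ be random with a joint law that is absolutely continuous with respect to Lebesgue measure on $(\mathbb R^d)^n$ (for instance, i.i.d. from a density on $\mathbb R^d$). Then almost surely, if all $\|z_i\|\le1$ and the data are linearly separable, $\bar u$ and $\bar v$ exist and are unique, and with $C=C(\gamma,\gamma',\|\bar v\|)$: - for all admissible steps and all $t\ge1$, $\displaystyle\Big\|\frac{w_t}{\|w_t\|}-\bar u\Big\|\le\frac{C\ln n}{\sum_{j<t}\hat\eta_j}$; - if $\hat\eta_j=1$ for all $j$, then $\displaystyle\Big\|\frac{w_t}{\|w_t\|}-\bar u\Big\|\le\frac{C\ln n}{t}$ for all $t\ge1$; - if $\eta_j=1$ for all $j$, then $\displaystyle\Big\|\frac{w_t}{\|w_t\|}-\bar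 u\Big\|\le\frac{C\ln n}{\ln t}$ for all $t\ge2$. **Lower bounds.** There are absolute constants $a,b>0$ such that for every $n\ge1$ there is a linearly separable dataset $z_1,\dots,z_n\in\mathbb R^2$ with $\|z_i\|\le1$ and a unique maximum margin direction $\bar u$, such that: - for all admissible steps and all sufficiently large $t$ (depending on the steps), $\displaystyle\Big\|\frac{w_t}{\|w_t\|}-\bar u\Big\|\ge\frac{\ln n-\ln 2}{\|w_t\|}$; - if $\hat\eta_j=1$ for all $j$, then for all sufficiently large $t$ the same bound holds, and $\displaystyle\Big\|\frac{w_t}{\|w_t\|}-\bar u\Big\|\ge\frac{\ln n-\ln 2}{t}$; - if $\eta_j=1$ for all $j$, then for all sufficiently large $t$ the same bound (with $\|w_t\|$) holds, and $a\ln t\le\|w_t\|\le b\ln t$. -/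

import Mathlib

open MeasureTheory Filter
open scoped ENNReal

noncomputable section

namespace ImplicitBias

/-- The space `ℝ^d` with the `ℓ₂` norm. -/
abbrev Vec (d : ℕ) : Type := EuclideanSpace ℝ (Fin d)

variable {n d : ℕ}

/-- A dataset is given by `z_i = - y_i x_i`; it is linearly separable if some `u` satisfies
`y_i ⟨u, x_i⟩ = ⟨u, -z_i⟩ > 0` for all `i`. -/
def Separable (Z : Fin n → Vec d) : Prop :=
  ∃ u : Vec d, ∀ i, 0 < inner ℝ u (-(Z i))

/-- The empirical risk for the exponential loss, `R(w) = (1/n) ∑ exp ⟨w, z_i⟩`. -/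
def risk (Z : Fin n → Vec d) (w : Vec d) : ℝ :=
  (1 / (n : ℝ)) * ∑ i, Real.exp (inner ℝ w (Z i))

/-- Gradient descent on the risk with steps `η`, started at `w₀ = 0`. -/
def iterate (Z : Fin n → Vec d) (η : ℕ → ℝ) : ℕ → Vec d
  | 0 => 0
  | t + 1 => iterate Z η t - η t • gradient (risk Z) (iterate Z η t)

/-- The normalized steps `η̂_t = η_t R(w_t)`. -/
def normStep (Z : Fin n → Vec d) (η : ℕ → ℝ) (t : ℕ) : ℝ :=
  η t * risk Z (iterate Z η t)

/-- `η̂_t` is nonincreasing and at most `1`, and `∑ η_j = ∞`. -/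
structure AdmissibleSteps (Z : Fin n → Vec d) (η : ℕ → ℝ) : Prop where
  le_one : ∀ t, normStep Z η t ≤ 1
  nonincreasing : Antitone (normStep Z η)
  sum_eq_top : Tendsto (fun t => ∑ j ∈ Finset.range t, η j) atTop atTop

/-- The margin `min_i y_i ⟨u, x_i⟩ = min_i ⟨u, -z_i⟩` of `u`. -/
def margin (Z : Fin n → Vec d) (u : Vec d) : ℝ :=
  ⨅ i, inner ℝ u (-(Z i))

/-- `u` maximizes the margin among the unit vectors. -/
def IsMaxMarginDirection (Z : Fin n → Vec d) (u : Vec d) : Prop :=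
  ‖u‖ = 1 ∧ ∀ u' : Vec d, ‖u'‖ = 1 → margin Z u' ≤ margin Z u

/-- For a maximum margin direction `u`: the indices of the support vectors. -/
def supportIndices (Z : Fin n → Vec d) (u : Vec d) : Set (Fin n) :=
  {i | inner ℝ u (-(Z i)) = margin Z u}

/-- For a maximum margin direction `u`: the margin `γ'` between support vectors and non-support
vectors; it is `∞` if all data are support vectors. -/
def supportGap (Z : Fin n → Vec d) (u : Vec d) : ℝ≥0∞ :=
  ⨅ i ∈ (supportIndices Z u)ᶜ, ENNReal.ofReal (inner ℝ u (-(Z i)) - margin Z u)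

/-- The component of `a` orthogonal to the unit vector `u`. -/
def orthPart (u a : Vec d) : Vec d := a - inner ℝ a u • u

open Classical in
/-- The risk induced by the components of the support vectors orthogonal to `u`. -/
def orthRisk (Z : Fin n → Vec d) (u w : Vec d) : ℝ :=
  (1 / (n : ℝ)) * ∑ i with i ∈ supportIndices Z u, Real.exp (inner ℝ w (orthPart u (Z i)))

/-- `v` minimizes `orthRisk Z u` over the span of the orthogonal components of the support
vectors. -/
def IsOrthMinimizer (Z : Fin n → Vec d) (u v : Vec d) : Prop :=
  v ∈ Submodule.span ℝ ((fun i => orthPart u (Z i)) '' supportIndices Z u) ∧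
    ∀ v' ∈ Submodule.span ℝ ((fun i => orthPart u (Z i)) '' supportIndices Z u),
      orthRisk Z u v ≤ orthRisk Z u v'

/-- The distance `‖ w_t / ‖w_t‖ - u ‖`. -/
def directionError (Z : Fin n → Vec d) (η : ℕ → ℝ) (u : Vec d) (t : ℕ) : ℝ :=
  ‖(‖iterate Z η t‖⁻¹ • iterate Z η t) - u‖

end ImplicitBias

end

/-!
Write `L` for log-sum-exp of the data and `g_t = ∇L(w_t)`, the mean of the data under the softmax
weights. Since `∇R = R • ∇L`, gradient descent is `w_{t+1} = w_t - η̂_t g_t`, with normalized steps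
`η̂_t ∈ (0, 1]`. Decompose `w_t = s_t ū + v_t` with `v_t` orthogonal to the maximum margin
direction `ū`. As `-g_t` has component at least `γ` along `ū`, one has `s_t ≥ γ ∑_{j<t} η̂_j`, so
for the upper bounds it suffices that `‖v_t‖ = O(ln n)`.

Two monotone quantities give this. By strong duality, `-γ ū` is a convex combination of the data;
hence the energy `L(w) + γ ⟨w, ū⟩` is nonnegative. It starts at `ln n`, and, as `L` is convex and
`1`-smooth (Hoeffding's lemma), cocoercivity of `∇L` shows that it decreases by at least
`η̂_t/2 ‖Π g_t‖²` in each step, where `Π` is the projection orthogonal to `ū`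
(`MarginCertificate.energy_step_le`). So the quadratic terms in the recursion for `‖v_t - v̄‖²` have
total size at most `2 ln n`. By convexity and the minimality of `v̄`, the linear terms can be
positive only through vectors outside the support, and are then at most
`n exp(2‖v̄‖) exp(-δ s_t)`, with `δ` the gap between the support and the other vectors
(`SupportCertificate.inner_orthPart_softMean_ge`). Once `s_t ≥ ln n / δ` these are summable with a
sum independent of `n`, and before that `‖w_t‖ ≤ ∑ η̂_j ≤ ln n / (δ γ)` plus one step
(`SupportCertificate.iterate_dichotomy`). For `n = 1` the energy is `0` throughout, and `v_t = 0`.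
For constant steps, `ln (t + 1) ≤ ∑ η̂_j` because `R(w_t) ≥ exp (-∑ η̂_j)`.

The minimizer `v̄` exists if every support vector has a positive dual weight. A support vector with
weight `0` lies on the hyperplane determined by the point of smallest norm in the convex hull of the
other vectors. The exceptional datasets form a countable union of closed sets, and by Fubini they
are a null set (`ae_dual_weights_pos`).

For the lower bounds, take one support vector on the first axis and `n - 1` copies of a vector with
larger margin which is tilted towards the second axis. Until the copies carry less than half of the
softmax weight, the second coordinate of `w_t` grows, and by then it has reached `ln n - ln 2`
(`tilted_dichotomy`).
-/

noncomputable section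

namespace ImplicitBias

variable {n d : ℕ}

/-! ### The log-sum-exp potential -/

/-- The unnormalized exponential loss `∑ exp ⟨w, z_i⟩`. -/
def expSum (Z : Fin n → Vec d) (w : Vec d) : ℝ := ∑ i, Real.exp (inner ℝ w (Z i))

/-- The softmax weights: the dual variable attached to the weight vector `w`. -/
def softWeight (Z : Fin n → Vec d) (w : Vec d) (i : Fin n) : ℝ :=
  Real.exp (inner ℝ w (Z i)) / expSum Z w

/-- The mean of the data under the softmax weights; it is the gradient of `logSumExp Z`. -/
def softMean (Z : Fin n → Vec d) (w : Vec d) : Vec d := ∑ i, softWeight Z w i • Z i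

/-- The potential `ln ∑ exp ⟨w, z_i⟩`. -/
def logSumExp (Z : Fin n → Vec d) (w : Vec d) : ℝ := Real.log (expSum Z w)

lemma expSum_pos (hn : 0 < n) (Z : Fin n → Vec d) (w : Vec d) : 0 < expSum Z w :=
  Finset.sum_pos (fun _ _ => Real.exp_pos _) ⟨⟨0, hn⟩, Finset.mem_univ _⟩

lemma softWeight_pos (hn : 0 < n) (Z : Fin n → Vec d) (w : Vec d) (i : Fin n) :
    0 < softWeight Z w i :=
  div_pos (Real.exp_pos _) (expSum_pos hn Z w)

lemma sum_softWeight (hn : 0 < n) (Z : Fin n → Vec d) (w : Vec d) :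
    ∑ i, softWeight Z w i = 1 := by
  simp only [softWeight, ← Finset.sum_div]
  exact div_self (expSum_pos hn Z w).ne'

lemma exp_logSumExp (hn : 0 < n) (Z : Fin n → Vec d) (w : Vec d) :
    Real.exp (logSumExp Z w) = expSum Z w := Real.exp_log (expSum_pos hn Z w)

lemma logSumExp_zero (Z : Fin n → Vec d) : logSumExp Z 0 = Real.log n := by
  simp [logSumExp, expSum]

lemma inner_softMean (Z : Fin n → Vec d) (w h : Vec d) :
    inner ℝ h (softMean Z w) = ∑ i, softWeight Z w i * inner ℝ h (Z i) := by
  simp [softMean, inner_sum, inner_smul_right]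

lemma norm_softMean_le (hn : 0 < n) {Z : Fin n → Vec d} (hZ : ∀ i, ‖Z i‖ ≤ 1) (w : Vec d) :
    ‖softMean Z w‖ ≤ 1 := by
  calc ‖softMean Z w‖ ≤ ∑ i, ‖softWeight Z w i • Z i‖ := norm_sum_le _ _
    _ ≤ ∑ i, softWeight Z w i := by
        refine Finset.sum_le_sum fun i _ => ?_
        rw [norm_smul, Real.norm_of_nonneg (softWeight_pos hn Z w i).le]
        exact mul_le_of_le_one_right (softWeight_pos hn Z w i).le (hZ i)
    _ = 1 := sum_softWeight hn Z w

/-- Increments of log-sum-exp are logarithmic moments under the softmax weights. -/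
lemma expSum_add (hn : 0 < n) (Z : Fin n → Vec d) (w h : Vec d) :
    expSum Z (w + h) = expSum Z w * ∑ i, softWeight Z w i * Real.exp (inner ℝ h (Z i)) := by
  rw [Finset.mul_sum]
  refine Finset.sum_congr rfl fun i _ => ?_
  have := (expSum_pos hn Z w).ne'
  rw [softWeight, inner_add_left, Real.exp_add]
  field_simp

/-- First-order convexity of log-sum-exp. -/
lemma logSumExp_add_inner_le (hn : 0 < n) (Z : Fin n → Vec d) (w h : Vec d) :
    logSumExp Z w + inner ℝ h (softMean Z w) ≤ logSumExp Z (w + h) := by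
  rw [← Real.exp_le_exp, Real.exp_add, exp_logSumExp hn, exp_logSumExp hn, expSum_add hn]
  refine mul_le_mul_of_nonneg_left ?_ (expSum_pos hn Z w).le
  set m := inner ℝ h (softMean Z w) with hm
  have h1 : ∑ i, softWeight Z w i * (inner ℝ h (Z i) - m + 1) = 1 := by
    simp only [mul_add, mul_sub, Finset.sum_add_distrib, Finset.sum_sub_distrib, mul_one,
      ← Finset.sum_mul, sum_softWeight hn, ← inner_softMean]
    rw [← hm]; ring
  calc Real.exp m
      = Real.exp m * ∑ i, softWeight Z w i * (inner ℝ h (Z i) - m + 1) := by rw [h1, mul_one]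
    _ ≤ Real.exp m * ∑ i, softWeight Z w i * Real.exp (inner ℝ h (Z i) - m) := by
        gcongr with i
        · exact (softWeight_pos hn Z w i).le
        · exact Real.add_one_le_exp _
    _ = ∑ i, softWeight Z w i * Real.exp (inner ℝ h (Z i)) := by
        rw [Finset.mul_sum]
        refine Finset.sum_congr rfl fun i _ => ?_
        rw [Real.exp_sub]
        field_simp

/-- Hoeffding's lemma for a finitely supported distribution on `[-a, a]`. -/
lemma sum_mul_exp_le {p x : Fin n → ℝ} {a : ℝ} (hp : ∀ i, 0 ≤ p i) (hp1 : ∑ i, p i = 1)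
    (hx : ∀ i, |x i| ≤ a) :
    ∑ i, p i * Real.exp (x i) ≤ Real.exp (∑ i, p i * x i + a ^ 2 / 2) := by
  let P : PMF (Fin n) := PMF.ofFintype (fun i => ENNReal.ofReal (p i)) (by
    rw [← ENNReal.ofReal_sum_of_nonneg fun i _ => hp i, hp1, ENNReal.ofReal_one])
  have hP : ∀ f : Fin n → ℝ, ∫ i, f i ∂P.toMeasure = ∑ i, p i * f i := fun f => by
    rw [PMF.integral_eq_sum]
    simp [P, ENNReal.toReal_ofReal (hp _)]
  have key := (ProbabilityTheory.hasSubgaussianMGF_of_mem_Icc (μ := P.toMeasure) (X := x)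
    (a := -a) (b := a) (measurable_of_finite x).aemeasurable
    (ae_of_all _ fun i => abs_le.1 (hx i))).mgf_le 1
  rw [ProbabilityTheory.mgf, hP, hP] at key
  have hc : (((‖a - -a‖₊ / 2) ^ 2 : NNReal) : ℝ) * 1 ^ 2 / 2 = a ^ 2 / 2 := by
    push_cast
    rw [div_pow, Real.norm_eq_abs, sq_abs]
    ring
  rw [hc] at key
  set m := ∑ i, p i * x i
  rw [Real.exp_add]
  calc ∑ i, p i * Real.exp (x i) = Real.exp m * ∑ i, p i * Real.exp (1 * (x i - m)) := by
        rw [Finset.mul_sum]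
        refine Finset.sum_congr rfl fun i _ => ?_
        rw [one_mul, Real.exp_sub]
        field_simp
    _ ≤ _ := by gcongr

/-- Log-sum-exp of data in the unit ball is `1`-smooth. -/
lemma logSumExp_add_le (hn : 0 < n) {Z : Fin n → Vec d} (hZ : ∀ i, ‖Z i‖ ≤ 1) (w h : Vec d) :
    logSumExp Z (w + h) ≤ logSumExp Z w + inner ℝ h (softMean Z w) + ‖h‖ ^ 2 / 2 := by
  rw [← Real.exp_le_exp, add_assoc, Real.exp_add, exp_logSumExp hn, exp_logSumExp hn,
    expSum_add hn, inner_softMean]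
  refine mul_le_mul_of_nonneg_left ?_ (expSum_pos hn Z w).le
  refine sum_mul_exp_le (fun i => (softWeight_pos hn Z w i).le) (sum_softWeight hn Z w) fun i => ?_
  exact (abs_real_inner_le_norm _ _).trans (mul_le_of_le_one_right (norm_nonneg _) (hZ i))

/-- Cocoercivity of the gradient of log-sum-exp, the usual consequence of convexity and
smoothness: compare both at the gradient step from `x` that minimizes the smooth upper bound. -/
lemma logSumExp_cocoercive (hn : 0 < n) {Z : Fin n → Vec d} (hZ : ∀ i, ‖Z i‖ ≤ 1)
    (x y : Vec d) :
    logSumExp Z y + inner ℝ (x - y) (softMean Z y) + ‖softMean Z x - softMean Z y‖ ^ 2 / 2 ≤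
      logSumExp Z x := by
  set δ := softMean Z x - softMean Z y with hδ
  have h1 := logSumExp_add_inner_le hn Z y (x - y - δ)
  have h2 := logSumExp_add_le hn hZ x (-δ)
  rw [show y + (x - y - δ) = x + -δ by abel] at h1
  have h3 : inner ℝ (x - y - δ) (softMean Z y) =
      inner ℝ (x - y) (softMean Z y) - inner ℝ δ (softMean Z y) := inner_sub_left _ _ _
  have h4 : inner ℝ δ (softMean Z x) - inner ℝ δ (softMean Z y) = ‖δ‖ ^ 2 := by
    rw [← inner_sub_right, ← hδ, real_inner_self_eq_norm_sq]
  rw [inner_neg_left, norm_neg] at h2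
  linarith

/-! ### Gradient descent -/

lemma risk_eq (Z : Fin n → Vec d) (w : Vec d) : risk Z w = expSum Z w / n := by
  rw [risk, expSum]; ring

lemma risk_pos (hn : 0 < n) (Z : Fin n → Vec d) (w : Vec d) : 0 < risk Z w := by
  rw [risk_eq]
  exact div_pos (expSum_pos hn Z w) (by exact_mod_cast hn)

lemma risk_zero (hn : 0 < n) (Z : Fin n → Vec d) : risk Z 0 = 1 := by
  have : (n : ℝ) ≠ 0 := by exact_mod_cast hn.ne'
  simp [risk, this]

lemma log_risk (hn : 0 < n) (Z : Fin n → Vec d) (w : Vec d) :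
    Real.log (risk Z w) = logSumExp Z w - Real.log n := by
  rw [risk_eq, Real.log_div (expSum_pos hn Z w).ne' (by exact_mod_cast hn.ne'), logSumExp]

lemma gradient_risk (hn : 0 < n) (Z : Fin n → Vec d) (w : Vec d) :
    gradient (risk Z) w = risk Z w • softMean Z w := by
  apply HasGradientAt.gradient
  have h : ∀ i, HasFDerivAt (fun w : Vec d => Real.exp (inner ℝ w (Z i)))
      (Real.exp (inner ℝ w (Z i)) • innerSL ℝ (Z i)) w := fun i => by
    have h0 : HasFDerivAt (fun w : Vec d => inner ℝ w (Z i)) (innerSL ℝ (Z i)) w := by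
      refine ((innerSL ℝ (Z i)).hasFDerivAt (x := w)).congr_of_eventuallyEq
        (Eventually.of_forall fun x => ?_)
      simp [real_inner_comm]
    exact h0.exp
  have h2 := (HasFDerivAt.fun_sum (u := Finset.univ) fun i _ => h i).const_mul (1 / (n : ℝ))
  rw [hasGradientAt_iff_hasFDerivAt]
  refine h2.congr_fderiv ?_
  ext y
  have := (expSum_pos hn Z w).ne'
  simp only [InnerProductSpace.toDual_apply_apply, inner_smul_left, real_inner_comm,
    inner_softMean, risk_eq]
  simp only [softWeight, Finset.mul_sum, _root_.smul_apply, smul_eq_mul,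
    _root_.sum_apply, innerSL_apply_apply, conj_trivial]
  refine Finset.sum_congr rfl fun i _ => ?_
  rw [real_inner_comm y]
  field_simp

/-- In terms of the normalized steps, gradient descent on the risk is gradient descent on
log-sum-exp. -/
lemma iterate_succ (hn : 0 < n) (Z : Fin n → Vec d) (η : ℕ → ℝ) (t : ℕ) :
    iterate Z η (t + 1) = iterate Z η t - normStep Z η t • softMean Z (iterate Z η t) := by
  rw [iterate, gradient_risk hn, smul_smul, normStep]

/-! ### Decomposition along a unit vector -/

lemma orthPart_sub (u a b : Vec d) : orthPart u (a - b) = orthPart u a - orthPart u b := by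
  simp only [orthPart, inner_sub_left, sub_smul]; abel

lemma orthPart_smul (u : Vec d) (c : ℝ) (a : Vec d) :
    orthPart u (c • a) = c • orthPart u a := by
  simp only [orthPart, inner_smul_left, smul_sub, smul_smul]; rfl

lemma orthPart_zero (u : Vec d) : orthPart u 0 = 0 := by simp [orthPart]

lemma orthPart_sum {ι : Type*} (u : Vec d) (s : Finset ι) (f : ι → Vec d) :
    orthPart u (∑ i ∈ s, f i) = ∑ i ∈ s, orthPart u (f i) := by
  simp only [orthPart, sum_inner, Finset.sum_smul, Finset.sum_sub_distrib]

lemma inner_orthPart_self {u : Vec d} (hu : ‖u‖ = 1) (a : Vec d) :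
    inner ℝ u (orthPart u a) = 0 := by
  simp [orthPart, inner_sub_right, inner_smul_right, hu, real_inner_comm]

lemma inner_eq_add_orthPart {u : Vec d} (hu : ‖u‖ = 1) (a b : Vec d) :
    inner ℝ a b = inner ℝ a u * inner ℝ u b + inner ℝ (orthPart u a) (orthPart u b) := by
  have ha : a = inner ℝ a u • u + orthPart u a := by simp [orthPart]
  conv_lhs => rw [ha, inner_add_left, inner_smul_left]
  have hb : b = inner ℝ b u • u + orthPart u b := by simp [orthPart]
  have h2 : inner ℝ (orthPart u a) b = inner ℝ (orthPart u a) (orthPart u b) := by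
    conv_lhs => rw [hb, inner_add_right, inner_smul_right, real_inner_comm u (orthPart u a),
      inner_orthPart_self hu, mul_zero, zero_add]
  rw [h2]; rfl

lemma norm_sq_eq_add_orthPart {u : Vec d} (hu : ‖u‖ = 1) (a : Vec d) :
    ‖a‖ ^ 2 = inner ℝ a u ^ 2 + ‖orthPart u a‖ ^ 2 := by
  rw [← real_inner_self_eq_norm_sq, inner_eq_add_orthPart hu, real_inner_self_eq_norm_sq,
    real_inner_comm a u]
  ring

lemma norm_orthPart_le {u : Vec d} (hu : ‖u‖ = 1) (a : Vec d) : ‖orthPart u a‖ ≤ ‖a‖ := by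
  have := norm_sq_eq_add_orthPart hu a
  exact abs_le_of_sq_le_sq' (by nlinarith [sq_nonneg (inner ℝ a u)]) (norm_nonneg _) |>.2

lemma norm_normalize_sub_le {u w : Vec d} (hu : ‖u‖ = 1) (hw : 0 < inner ℝ w u) :
    ‖(‖w‖⁻¹ • w) - u‖ ≤ 2 * ‖orthPart u w‖ / ‖w‖ := by
  have hw0 : 0 < ‖w‖ := norm_pos_iff.2 (by rintro rfl; simp at hw)
  have h1 : (‖w‖⁻¹ • w) - u = ‖w‖⁻¹ • (orthPart u w - (‖w‖ - inner ℝ w u) • u) := by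
    have : ‖w‖⁻¹ • ‖w‖ • u = u := by rw [smul_smul, inv_mul_cancel₀ hw0.ne', one_smul]
    rw [orthPart, sub_smul, smul_sub, smul_sub, smul_sub, this]; abel
  have h2 : ‖w‖ - inner ℝ w u ≤ ‖orthPart u w‖ := by
    have := norm_sub_norm_le w (inner ℝ w u • u)
    rwa [norm_smul, hu, mul_one, Real.norm_of_nonneg hw.le] at this
  have h3 : 0 ≤ ‖w‖ - inner ℝ w u := by
    have := real_inner_le_norm w u
    rw [hu, mul_one] at this; linarith
  have h4 : ‖orthPart u w - (‖w‖ - inner ℝ w u) • u‖ ≤ 2 * ‖orthPart u w‖ := by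
    refine (norm_sub_le _ _).trans ?_
    rw [norm_smul, hu, mul_one, Real.norm_of_nonneg h3]
    linarith
  rw [h1, norm_smul, norm_inv, norm_norm, div_eq_inv_mul]
  gcongr

/-! ### The primal-dual energy -/

/-- `u` is a unit vector which classifies data in the unit ball with margin at least `γ > 0`, and
a convex combination of the data certifies that no unit vector has a larger margin. -/
structure MarginCertificate (Z : Fin n → Vec d) (u : Vec d) (γ : ℝ) : Prop where
  card_pos : 0 < n
  norm_le : ∀ i, ‖Z i‖ ≤ 1
  unit : ‖u‖ = 1
  pos : 0 < γ
  margin_le : ∀ i, inner ℝ u (Z i) ≤ -γ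
  dual : ∃ q : Fin n → ℝ, (∀ i, 0 ≤ q i) ∧ ∑ i, q i = 1 ∧ ∑ i, q i • Z i = -(γ • u)

/-- The primal-dual energy. Up to the entropy of the dual optimum, it is the relative entropy
between the dual optimum and the softmax weights at `w`. -/
def energy (Z : Fin n → Vec d) (u : Vec d) (γ : ℝ) (w : Vec d) : ℝ :=
  logSumExp Z w + γ * inner ℝ w u

lemma energy_zero (Z : Fin n → Vec d) (u : Vec d) (γ : ℝ) : energy Z u γ 0 = Real.log n := by
  simp [energy, logSumExp_zero]

lemma inner_le_logSumExp (hn : 0 < n) (Z : Fin n → Vec d) (w : Vec d) (i : Fin n) :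
    inner ℝ w (Z i) ≤ logSumExp Z w := by
  rw [← Real.exp_le_exp, exp_logSumExp hn]
  exact Finset.single_le_sum (f := fun i => Real.exp (inner ℝ w (Z i)))
    (fun _ _ => (Real.exp_pos _).le) (Finset.mem_univ i)

namespace MarginCertificate

variable {Z : Fin n → Vec d} {u : Vec d} {γ : ℝ}

lemma energy_nonneg (H : MarginCertificate Z u γ) (w : Vec d) : 0 ≤ energy Z u γ w := by
  obtain ⟨q, hq, hq1, hqz⟩ := H.dual
  have h1 : ∑ i, q i * inner ℝ w (Z i) ≤ ∑ i, q i * logSumExp Z w :=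
    Finset.sum_le_sum fun i _ =>
      mul_le_mul_of_nonneg_left (inner_le_logSumExp H.card_pos Z w i) (hq i)
  have h2 : ∑ i, q i * inner ℝ w (Z i) = -(γ * inner ℝ w u) := by
    rw [← inner_smul_right, ← inner_neg_right, ← hqz, inner_sum]
    simp [inner_smul_right]
  rw [← Finset.sum_mul, hq1, one_mul, h2] at h1
  rw [energy]; linarith

lemma inner_softMean_le (H : MarginCertificate Z u γ) (w : Vec d) :
    inner ℝ (softMean Z w) u ≤ -γ := by
  rw [real_inner_comm, inner_softMean]
  calc ∑ i, softWeight Z w i * inner ℝ u (Z i) ≤ ∑ i, softWeight Z w i * -γ :=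
        Finset.sum_le_sum fun i _ =>
          mul_le_mul_of_nonneg_left (H.margin_le i) (softWeight_pos H.card_pos Z w i).le
    _ = -γ := by rw [← Finset.sum_mul, sum_softWeight H.card_pos, one_mul]

lemma le_norm_softMean (H : MarginCertificate Z u γ) (w : Vec d) : γ ≤ ‖softMean Z w‖ := by
  have h1 := H.inner_softMean_le w
  have h2 := neg_le_of_abs_le (abs_real_inner_le_norm (softMean Z w) u)
  rw [H.unit, mul_one] at h2
  linarith

lemma margin_le_one (H : MarginCertificate Z u γ) : γ ≤ 1 :=
  (H.le_norm_softMean 0).trans (norm_softMean_le H.card_pos H.norm_le 0)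

end MarginCertificate

lemma logSumExp_step_le (hn : 0 < n) {Z : Fin n → Vec d} (hZ : ∀ i, ‖Z i‖ ≤ 1) (w : Vec d)
    {h : ℝ} (h1 : h ≤ 1) :
    logSumExp Z (w - h • softMean Z w) ≤ logSumExp Z w -
      h / 2 * (‖softMean Z w‖ ^ 2 + ‖softMean Z (w - h • softMean Z w)‖ ^ 2) := by
  set w' := w - h • softMean Z w with hw'
  have key := logSumExp_cocoercive hn hZ w w'
  have e1 : w - w' = h • softMean Z w := by rw [hw']; abel
  rw [e1, inner_smul_left, norm_sub_sq_real] at key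
  have e2 := norm_sub_sq_real (softMean Z w) (softMean Z w')
  have e3 := sq_nonneg ‖softMean Z w - softMean Z w'‖
  simp only [conj_trivial] at key
  nlinarith

/-- The energy decreases at each step, by at least the squared length of the component of the
gradient orthogonal to the maximum margin direction. -/
lemma MarginCertificate.energy_step_le {Z : Fin n → Vec d} {u : Vec d} {γ : ℝ}
    (H : MarginCertificate Z u γ) (w : Vec d) {h : ℝ} (h0 : 0 ≤ h) (h1 : h ≤ 1) :
    energy Z u γ (w - h • softMean Z w) ≤
      energy Z u γ w - h / 2 * ‖orthPart u (softMean Z w)‖ ^ 2 := by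
  have key := logSumExp_step_le H.card_pos H.norm_le w h1
  have e1 := norm_sq_eq_add_orthPart H.unit (softMean Z w)
  have e2 := H.le_norm_softMean (w - h • softMean Z w)
  rw [energy, energy, inner_sub_left, inner_smul_left, conj_trivial]
  set g := inner ℝ (softMean Z w) u
  set b := ‖softMean Z (w - h • softMean Z w)‖
  have e3 : γ ^ 2 ≤ b ^ 2 := pow_le_pow_left₀ H.pos.le e2 2
  have e4 : 0 ≤ h / 2 * ((g + γ) ^ 2 + (b ^ 2 - γ ^ 2)) := by
    have := sq_nonneg (g + γ)
    have : 0 ≤ b ^ 2 - γ ^ 2 := by linarith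
    positivity
  rw [e1] at key
  nlinarith

/-! ### Growth of the iterates -/

section Growth

variable {Z : Fin n → Vec d} {u : Vec d} {γ : ℝ} {η : ℕ → ℝ}

/-- The accumulated normalized steps `∑_{j<t} η̂_j`. -/
def totalStep (Z : Fin n → Vec d) (η : ℕ → ℝ) (t : ℕ) : ℝ :=
  ∑ j ∈ Finset.range t, normStep Z η j

lemma totalStep_succ (t : ℕ) : totalStep Z η (t + 1) = totalStep Z η t + normStep Z η t :=
  Finset.sum_range_succ _ _

lemma norm_iterate_le (hn : 0 < n) (hZ : ∀ i, ‖Z i‖ ≤ 1) (h0 : ∀ t, 0 ≤ normStep Z η t) (t : ℕ) :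
    ‖iterate Z η t‖ ≤ totalStep Z η t := by
  induction t with
  | zero => simp [iterate, totalStep]
  | succ t ih =>
    rw [iterate_succ hn, totalStep_succ]
    refine (norm_sub_le _ _).trans (add_le_add ih ?_)
    rw [norm_smul, Real.norm_of_nonneg (h0 t)]
    exact mul_le_of_le_one_right (h0 t) (norm_softMean_le hn hZ _)

lemma MarginCertificate.inner_iterate_succ_ge (H : MarginCertificate Z u γ)
    (h0 : ∀ t, 0 ≤ normStep Z η t) (t : ℕ) :
    inner ℝ (iterate Z η t) u + normStep Z η t * γ ≤ inner ℝ (iterate Z η (t + 1)) u := by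
  rw [iterate_succ H.card_pos, inner_sub_left, inner_smul_left, conj_trivial]
  have := mul_le_mul_of_nonneg_left (H.inner_softMean_le (iterate Z η t)) (h0 t)
  linarith

lemma MarginCertificate.mul_totalStep_le_inner (H : MarginCertificate Z u γ)
    (h0 : ∀ t, 0 ≤ normStep Z η t) (t : ℕ) :
    γ * totalStep Z η t ≤ inner ℝ (iterate Z η t) u := by
  induction t with
  | zero => simp [iterate, totalStep]
  | succ t ih =>
    have := H.inner_iterate_succ_ge h0 t
    rw [totalStep_succ]; linarith

lemma MarginCertificate.energy_iterate_le (H : MarginCertificate Z u γ)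
    (h0 : ∀ t, 0 ≤ normStep Z η t) (h1 : ∀ t, normStep Z η t ≤ 1) (t : ℕ) :
    energy Z u γ (iterate Z η t) ≤ Real.log n := by
  induction t with
  | zero => simp [iterate, energy_zero]
  | succ t ih =>
    have := H.energy_step_le (iterate Z η t) (h0 t) (h1 t)
    rw [← iterate_succ H.card_pos] at this
    have h2 : 0 ≤ normStep Z η t / 2 * ‖orthPart u (softMean Z (iterate Z η t))‖ ^ 2 :=
      mul_nonneg (by linarith [h0 t]) (sq_nonneg _)
    linarith

/-- Admissible steps are positive: otherwise the normalized steps, and with them the steps, would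
be nonpositive from some time on. -/
lemma AdmissibleSteps.normStep_pos (hn : 0 < n) (h : AdmissibleSteps Z η) (t : ℕ) :
    0 < normStep Z η t := by
  by_contra! ht
  have h1 : ∀ j, t ≤ j → η j ≤ 0 := fun j hj => by
    by_contra! hpos
    have := mul_pos hpos (risk_pos hn Z (iterate Z η j))
    have h2 := h.nonincreasing hj
    rw [normStep] at h2
    linarith
  obtain ⟨T, hT1, hT2⟩ := ((eventually_ge_atTop t).and
    (h.sum_eq_top.eventually_gt_atTop (∑ j ∈ Finset.range t, η j))).exists
  rw [← Finset.sum_range_add_sum_Ico _ hT1] at hT2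
  have := Finset.sum_nonpos (s := Finset.Ico t T) (f := η) fun j hj =>
    h1 j (Finset.mem_Ico.1 hj).1
  linarith

/-- If the normalized steps were summable, the iterates would stay bounded and the risk would
stay away from `0`, so that the steps would be summable. -/
lemma AdmissibleSteps.tendsto_totalStep (hn : 0 < n) (hZ : ∀ i, ‖Z i‖ ≤ 1)
    (h : AdmissibleSteps Z η) : Tendsto (totalStep Z η) atTop atTop := by
  have h0 := fun t => (h.normStep_pos hn t).le
  have hmono : Monotone (totalStep Z η) := monotone_nat_of_le_succ fun t => by
    rw [totalStep_succ]; linarith [h0 t]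
  refine tendsto_atTop_atTop_of_monotone hmono fun M => ?_
  by_contra! hM
  have hrisk : ∀ t, Real.exp (-M) ≤ risk Z (iterate Z η t) := fun t => by
    rw [risk_eq, le_div_iff₀ (by exact_mod_cast hn), expSum]
    have : ∀ i, Real.exp (-M) ≤ Real.exp (inner ℝ (iterate Z η t) (Z i)) := fun i => by
      rw [Real.exp_le_exp]
      have h2 := neg_le_of_abs_le (abs_real_inner_le_norm (iterate Z η t) (Z i))
      have h3 := mul_le_of_le_one_right (norm_nonneg (iterate Z η t)) (hZ i)
      have h4 := norm_iterate_le hn hZ h0 t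
      linarith [hM t]
    calc Real.exp (-M) * n = ∑ _i : Fin n, Real.exp (-M) := by simp [mul_comm]
      _ ≤ _ := Finset.sum_le_sum fun i _ => this i
  have hη : ∀ t, η t ≤ Real.exp M * normStep Z η t := fun t => by
    have hpos : 0 < η t := by
      have := h.normStep_pos hn t
      rw [normStep] at this
      exact pos_of_mul_pos_left this (risk_pos hn _ _).le
    rw [normStep]
    calc η t = Real.exp M * (η t * Real.exp (-M)) := by
          rw [Real.exp_neg]; field_simp
      _ ≤ _ := by gcongr; exact hrisk t
  obtain ⟨T, hT⟩ := (h.sum_eq_top.eventually_gt_atTop (Real.exp M * M)).exists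
  have : ∑ j ∈ Finset.range T, η j ≤ Real.exp M * totalStep Z η T := by
    rw [totalStep, Finset.mul_sum]
    exact Finset.sum_le_sum fun j _ => hη j
  have h5 : Real.exp M * totalStep Z η T ≤ Real.exp M * M := by
    gcongr; exact (hM T).le
  linarith

/-- Along gradient descent with normalized steps in `[0, 1]` the risk decreases. -/
lemma risk_iterate_succ_le (hn : 0 < n) (hZ : ∀ i, ‖Z i‖ ≤ 1) {t : ℕ}
    (h0 : 0 ≤ normStep Z η t) (h1 : normStep Z η t ≤ 1) :
    risk Z (iterate Z η (t + 1)) ≤ risk Z (iterate Z η t) := by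
  have key := logSumExp_step_le hn hZ (iterate Z η t) h1
  rw [← iterate_succ hn] at key
  have h2 : 0 ≤ normStep Z η t / 2 * (‖softMean Z (iterate Z η t)‖ ^ 2 +
      ‖softMean Z (iterate Z η (t + 1))‖ ^ 2) := by positivity
  rw [← Real.log_le_log_iff (risk_pos hn _ _) (risk_pos hn _ _), log_risk hn, log_risk hn]
  linarith

lemma normStep_of_eq_one (hη : ∀ j, η j = 1) (t : ℕ) :
    normStep Z η t = risk Z (iterate Z η t) := by
  rw [normStep, hη, one_mul]

/-- Constant steps `1` are admissible. -/
lemma admissibleSteps_of_step_eq_one (hn : 0 < n) (hZ : ∀ i, ‖Z i‖ ≤ 1) (hη : ∀ j, η j = 1) :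
    AdmissibleSteps Z η := by
  have h0 : ∀ t, 0 ≤ normStep Z η t := fun t => by
    rw [normStep_of_eq_one hη]; exact (risk_pos hn _ _).le
  have h1 : ∀ t, normStep Z η t ≤ 1 := fun t => by
    induction t with
    | zero => rw [normStep_of_eq_one hη, iterate, risk_zero hn]
    | succ t ih =>
      have := risk_iterate_succ_le hn hZ (h0 t) ih
      rw [← normStep_of_eq_one hη, ← normStep_of_eq_one hη] at this
      linarith
  refine ⟨h1, antitone_nat_of_succ_le fun t => ?_, ?_⟩
  · rw [normStep_of_eq_one hη, normStep_of_eq_one hη]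
    exact risk_iterate_succ_le hn hZ (h0 t) (h1 t)
  · simpa [hη] using tendsto_natCast_atTop_atTop (R := ℝ)

/-- Normalized steps `1` are admissible. -/
lemma admissibleSteps_of_normStep_eq_one (hn : 0 < n) (hZ : ∀ i, ‖Z i‖ ≤ 1)
    (hη : ∀ j, normStep Z η j = 1) : AdmissibleSteps Z η := by
  have hR : ∀ t, risk Z (iterate Z η t) ≤ 1 := fun t => by
    induction t with
    | zero => rw [iterate, risk_zero hn]
    | succ t ih => exact (risk_iterate_succ_le hn hZ (by simp [hη]) (hη t).le).trans ih
  have h1 : ∀ t, 1 ≤ η t := fun t => by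
    have h2 := hη t
    rw [normStep] at h2
    have hpos := risk_pos hn Z (iterate Z η t)
    have : 0 < η t := pos_of_mul_pos_left (by rw [h2]; exact one_pos) hpos.le
    nlinarith [hR t]
  refine ⟨fun t => (hη t).le, fun s t _ => by rw [hη, hη], ?_⟩
  refine tendsto_atTop_mono (fun t => ?_) (tendsto_natCast_atTop_atTop (R := ℝ))
  calc (t : ℝ) = ∑ j ∈ Finset.range t, 1 := by simp
    _ ≤ _ := Finset.sum_le_sum fun j _ => h1 j

lemma totalStep_of_normStep_eq_one (hη : ∀ j, normStep Z η j = 1) (t : ℕ) :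
    totalStep Z η t = t := by simp [totalStep, hη]

/-- The risk decays at most like `exp (-∑ η̂_j)`, because the softmax means have norm at most
`1`. -/
lemma neg_totalStep_le_log_risk (hn : 0 < n) (hZ : ∀ i, ‖Z i‖ ≤ 1)
    (h0 : ∀ t, 0 ≤ normStep Z η t) (t : ℕ) :
    -totalStep Z η t ≤ Real.log (risk Z (iterate Z η t)) := by
  induction t with
  | zero => simp [totalStep, iterate, risk_zero hn]
  | succ t ih =>
    have key := logSumExp_add_inner_le hn Z (iterate Z η t)
      (-(normStep Z η t • softMean Z (iterate Z η t)))
    rw [← sub_eq_add_neg, ← iterate_succ hn, inner_neg_left, inner_smul_left,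
      real_inner_self_eq_norm_sq, conj_trivial] at key
    have h1 : normStep Z η t * ‖softMean Z (iterate Z η t)‖ ^ 2 ≤ normStep Z η t :=
      mul_le_of_le_one_right (h0 t)
        (pow_le_one₀ (norm_nonneg _) (norm_softMean_le hn hZ _))
    rw [log_risk hn] at ih ⊢
    rw [totalStep_succ]
    linarith

/-- With constant steps `1` the accumulated normalized steps satisfy `A_{t+1} ≥ A_t + exp (-A_t)`,
whence they grow at least logarithmically. -/
lemma log_le_totalStep (hn : 0 < n) (hZ : ∀ i, ‖Z i‖ ≤ 1) (hη : ∀ j, η j = 1) (t : ℕ) :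
    Real.log (t + 1) ≤ totalStep Z η t := by
  have h0 : ∀ t, 0 ≤ normStep Z η t := fun t => by
    rw [normStep_of_eq_one hη]; exact (risk_pos hn _ _).le
  rw [Real.log_le_iff_le_exp (by positivity)]
  induction t with
  | zero => simp [totalStep]
  | succ t ih =>
    have h1 := neg_totalStep_le_log_risk hn hZ h0 t
    rw [Real.le_log_iff_exp_le (risk_pos hn _ _), ← normStep_of_eq_one hη] at h1
    rw [totalStep_succ, Real.exp_add]
    have h2 := Real.add_one_le_exp (normStep Z η t)
    calc ((t + 1 : ℕ) : ℝ) + 1 ≤ Real.exp (totalStep Z η t) + 1 := by push_cast; linarith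
      _ = Real.exp (totalStep Z η t) * (Real.exp (-totalStep Z η t) + 1) := by
          rw [mul_add, ← Real.exp_add]; simp [add_comm]
      _ ≤ _ := by gcongr; linarith

/-- With constant steps `1` the risk is at most `exp (-γ² A_t)`, so that the accumulated
normalized steps `A_t` grow at most logarithmically. -/
lemma MarginCertificate.totalStep_le_log (H : MarginCertificate Z u γ) (hη : ∀ j, η j = 1)
    (t : ℕ) : γ ^ 2 * totalStep Z η t ≤ Real.log (1 + 2 * t) := by
  have hadm := admissibleSteps_of_step_eq_one H.card_pos H.norm_le hη
  have h0 := fun t => (hadm.normStep_pos H.card_pos t).le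
  rw [Real.le_log_iff_exp_le (by positivity)]
  have hγ : γ ^ 2 ≤ 1 := pow_le_one₀ H.pos.le H.margin_le_one
  induction t with
  | zero => simp [totalStep]
  | succ t ih =>
    set A := totalStep Z η t with hA
    set h := normStep Z η t with hh
    have hR : h ≤ Real.exp (-(γ ^ 2 * A)) := by
      have h1 := H.energy_iterate_le h0 hadm.le_one t
      have h2 := H.mul_totalStep_le_inner h0 t
      rw [energy] at h1
      rw [hh, normStep_of_eq_one hη, ← Real.log_le_iff_le_exp (risk_pos H.card_pos _ _),
        log_risk H.card_pos]
      nlinarith [H.pos]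
    have hx0 : 0 ≤ γ ^ 2 * h := mul_nonneg (sq_nonneg _) (h0 t)
    have hx1 : γ ^ 2 * h ≤ 1 := mul_le_one₀ hγ (h0 t) (hadm.le_one t)
    have hexp : Real.exp (γ ^ 2 * h) ≤ 1 + 2 * (γ ^ 2 * h) := by
      have := Real.abs_exp_sub_one_le (x := γ ^ 2 * h) (by rwa [abs_of_nonneg hx0])
      rw [abs_of_nonneg hx0] at this
      linarith [le_abs_self (Real.exp (γ ^ 2 * h) - 1)]
    have h3 : γ ^ 2 * h ≤ Real.exp (-(γ ^ 2 * A)) :=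
      (mul_le_of_le_one_left (h0 t) hγ).trans hR
    rw [totalStep_succ, mul_add, Real.exp_add]
    calc Real.exp (γ ^ 2 * A) * Real.exp (γ ^ 2 * h)
        ≤ Real.exp (γ ^ 2 * A) * (1 + 2 * Real.exp (-(γ ^ 2 * A))) := by gcongr; linarith
      _ = Real.exp (γ ^ 2 * A) + 2 := by
          rw [mul_add, mul_left_comm, ← Real.exp_add]; simp
      _ ≤ 1 + 2 * ((t + 1 : ℕ) : ℝ) := by push_cast; linarith

end Growth

/-! ### The orthogonal component of the iterates -/

/-- A `MarginCertificate` with support vectors `S`, for which `v` minimizes the risk of the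
orthogonal components and the other vectors have margin at least `γ + δ`. -/
structure SupportCertificate (Z : Fin n → Vec d) (u v : Vec d) (γ δ : ℝ) (S : Finset (Fin n)) :
    Prop extends MarginCertificate Z u γ where
  gap_pos : 0 < δ
  support_nonempty : S.Nonempty
  support_eq : ∀ i ∈ S, inner ℝ u (Z i) = -γ
  gap_le : ∀ i ∉ S, inner ℝ u (Z i) ≤ -(γ + δ)
  minimal : ∀ w : Vec d, ∑ i ∈ S, Real.exp (inner ℝ v (orthPart u (Z i))) ≤
    ∑ i ∈ S, Real.exp (inner ℝ w (orthPart u (Z i)))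

/-- The weight of the exponential term in the potential: it is so large that the decrease of this
term pays for the influence of the vectors outside the support. -/
def gapConst (γ δ r : ℝ) : ℝ := Real.exp (2 * r) * Real.exp (δ * γ) / (δ * γ)

/-- A bound for the orthogonal component of the iterates, as a multiple of `ln n`. -/
def biasConst (γ δ r : ℝ) : ℝ :=
  2 * r + Real.sqrt ((2 * r + 1 / (δ * γ) + 2) ^ 2 + 4 + 8 * gapConst γ δ r)

lemma gapConst_pos {γ δ : ℝ} (hγ : 0 < γ) (hδ : 0 < δ) (r : ℝ) : 0 < gapConst γ δ r := by
  unfold gapConst; positivity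

/-- The potential: the distance of the orthogonal component to `v`, the energy, and a term which
compensates the error in
`SupportCertificate.inner_orthPart_softMean_ge`. -/
def biasPotential (Z : Fin n → Vec d) (u v : Vec d) (γ δ : ℝ) (w : Vec d) : ℝ :=
  ‖orthPart u w - v‖ ^ 2 + 2 * energy Z u γ w +
    2 * gapConst γ δ ‖v‖ * (n * Real.exp (-(δ * inner ℝ w u)))

lemma mul_exp_neg_le_one_sub {c h : ℝ} (hc : 0 ≤ c) (h0 : 0 ≤ h) (h1 : h ≤ 1) :
    c * h * Real.exp (-c) ≤ 1 - Real.exp (-(c * h)) := by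
  have h2 : Real.exp (-c) ≤ Real.exp (-(c * h)) :=
    Real.exp_le_exp.2 (neg_le_neg (mul_le_of_le_one_right hc h1))
  have h3 : (c * h + 1) * Real.exp (-(c * h)) ≤ 1 := by
    calc (c * h + 1) * Real.exp (-(c * h)) ≤ Real.exp (c * h) * Real.exp (-(c * h)) := by
          gcongr; exact Real.add_one_le_exp _
      _ = 1 := by rw [← Real.exp_add]; simp
  have h4 : c * h * Real.exp (-c) ≤ c * h * Real.exp (-(c * h)) := by gcongr
  linarith

/-- For a single vector the iterates never leave the line spanned by `u`, because the energy,
which starts at `ln 1 = 0`, bounds the orthogonal components of the gradients. -/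
lemma MarginCertificate.orthPart_iterate_eq_zero {Z : Fin 1 → Vec d} {u : Vec d} {γ : ℝ}
    {η : ℕ → ℝ} (H : MarginCertificate Z u γ)
    (h0 : ∀ t, 0 ≤ normStep Z η t) (h1 : ∀ t, normStep Z η t ≤ 1) (t : ℕ) :
    orthPart u (iterate Z η t) = 0 := by
  induction t with
  | zero => simp [iterate, orthPart_zero]
  | succ t ih =>
    have h2 := H.energy_step_le (iterate Z η t) (h0 t) (h1 t)
    have h3 := H.energy_iterate_le h0 h1 t
    have h4 := H.energy_nonneg (iterate Z η t - normStep Z η t • softMean Z (iterate Z η t))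
    have h5 : normStep Z η t / 2 * ‖orthPart u (softMean Z (iterate Z η t))‖ ^ 2 ≤ 0 := by
      simp only [Nat.cast_one, Real.log_one] at h3
      linarith
    have h6 : normStep Z η t • orthPart u (softMean Z (iterate Z η t)) = 0 := by
      rcases (h0 t).eq_or_lt with h | h
      · rw [← h, zero_smul]
      · have : ‖orthPart u (softMean Z (iterate Z η t))‖ = 0 := by
          by_contra hne
          have : 0 < ‖orthPart u (softMean Z (iterate Z η t))‖ :=
            lt_of_le_of_ne (norm_nonneg _) (Ne.symm hne)
          have : 0 < normStep Z η t / 2 * ‖orthPart u (softMean Z (iterate Z η t))‖ ^ 2 := by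
            positivity
          linarith
        rw [norm_eq_zero.1 this, smul_zero]
    rw [iterate_succ H.card_pos, orthPart_sub, orthPart_smul, ih, h6, sub_zero]

namespace SupportCertificate

variable {Z : Fin n → Vec d} {u v : Vec d} {γ δ : ℝ} {S : Finset (Fin n)} {η : ℕ → ℝ}

lemma norm_orthPart_le_one (H : SupportCertificate Z u v γ δ S) (i : Fin n) :
    ‖orthPart u (Z i)‖ ≤ 1 :=
  (norm_orthPart_le H.unit _).trans (H.norm_le i)

lemma exp_inner_eq (H : SupportCertificate Z u v γ δ S) (w : Vec d) (i : Fin n) :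
    Real.exp (inner ℝ w (Z i)) = Real.exp (inner ℝ w u * inner ℝ u (Z i)) *
      Real.exp (inner ℝ (orthPart u w) (orthPart u (Z i))) := by
  rw [inner_eq_add_orthPart H.unit, Real.exp_add]

lemma exp_le_expSum (H : SupportCertificate Z u v γ δ S) (w : Vec d) :
    Real.exp (-(γ * inner ℝ w u)) * Real.exp (-‖v‖) ≤ expSum Z w := by
  obtain ⟨i₀, hi₀⟩ := H.support_nonempty
  have h1 : Real.exp (-‖v‖) ≤ ∑ i ∈ S, Real.exp (inner ℝ v (orthPart u (Z i))) := by
    refine le_trans ?_ (Finset.single_le_sum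
      (f := fun i => Real.exp (inner ℝ v (orthPart u (Z i)))) (fun _ _ => (Real.exp_pos _).le) hi₀)
    rw [Real.exp_le_exp]
    refine le_trans (neg_le_neg ?_) (neg_le_of_abs_le (abs_real_inner_le_norm _ _))
    exact mul_le_of_le_one_right (norm_nonneg _) (H.norm_orthPart_le_one i₀)
  calc Real.exp (-(γ * inner ℝ w u)) * Real.exp (-‖v‖)
      ≤ Real.exp (-(γ * inner ℝ w u)) *
          ∑ i ∈ S, Real.exp (inner ℝ (orthPart u w) (orthPart u (Z i))) := by
        gcongr; exact h1.trans (H.minimal _)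
    _ = ∑ i ∈ S, Real.exp (inner ℝ w (Z i)) := by
        rw [Finset.mul_sum]
        refine Finset.sum_congr rfl fun i hi => ?_
        rw [H.exp_inner_eq, H.support_eq i hi]
        congr 2; ring
    _ ≤ expSum Z w :=
        Finset.sum_le_sum_of_subset_of_nonneg (Finset.subset_univ _)
          fun _ _ _ => (Real.exp_pos _).le

/-- The gradient step moves the orthogonal component towards `v`, up to an error which decays
exponentially with the length of the iterate along `u`: by convexity, the contribution of each
vector is at least the difference of its losses, and the support vectors contribute a nonnegative
amount by the minimality of `v`. -/
lemma inner_orthPart_softMean_ge (H : SupportCertificate Z u v γ δ S) {w : Vec d}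
    (hs : 0 ≤ inner ℝ w u) :
    -(n * Real.exp (2 * ‖v‖) * Real.exp (-(δ * inner ℝ w u))) ≤
      inner ℝ (orthPart u w - v) (orthPart u (softMean Z w)) := by
  set s := inner ℝ w u with hs_def
  set E := expSum Z w with hE
  have hEpos : 0 < E := expSum_pos H.card_pos Z w
  set a : Fin n → ℝ := fun i => inner ℝ (orthPart u w) (orthPart u (Z i))
  set b : Fin n → ℝ := fun i => inner ℝ v (orthPart u (Z i))
  have h1 : inner ℝ (orthPart u w - v) (orthPart u (softMean Z w)) =
      (∑ i, Real.exp (s * inner ℝ u (Z i)) * (Real.exp (a i) * (a i - b i))) / E := by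
    rw [softMean, orthPart_sum, inner_sum, Finset.sum_div]
    refine Finset.sum_congr rfl fun i _ => ?_
    rw [orthPart_smul, inner_smul_right, inner_sub_left, softWeight, H.exp_inner_eq]
    ring
  have hconv : ∀ i, Real.exp (a i) - Real.exp (b i) ≤ Real.exp (a i) * (a i - b i) := fun i => by
    have h2 := Real.add_one_le_exp (b i - a i)
    have h3 : Real.exp (b i) = Real.exp (a i) * Real.exp (b i - a i) := by
      rw [← Real.exp_add]; congr 1; ring
    rw [h3]
    nlinarith [Real.exp_pos (a i)]
  have hin : ∑ i ∈ S, Real.exp (s * inner ℝ u (Z i)) * (Real.exp (a i) * (a i - b i)) ≥ 0 := by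
    calc (0 : ℝ) ≤ Real.exp (s * -γ) * (∑ i ∈ S, Real.exp (a i) - ∑ i ∈ S, Real.exp (b i)) :=
          mul_nonneg (Real.exp_pos _).le (sub_nonneg.2 (H.minimal _))
      _ ≤ _ := by
          rw [← Finset.sum_sub_distrib, Finset.mul_sum]
          refine Finset.sum_le_sum fun i hi => ?_
          rw [H.support_eq i hi]
          exact mul_le_mul_of_nonneg_left (hconv i) (Real.exp_pos _).le
  have hout : -(n * (Real.exp (-((γ + δ) * s)) * Real.exp ‖v‖)) ≤
      ∑ i ∈ Sᶜ, Real.exp (s * inner ℝ u (Z i)) * (Real.exp (a i) * (a i - b i)) := by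
    set T := Real.exp (-((γ + δ) * s)) * Real.exp ‖v‖
    have hT : 0 ≤ T := by positivity
    have hcard : ((Sᶜ : Finset (Fin n)).card : ℝ) ≤ n := by
      have := Finset.card_le_univ (Sᶜ : Finset (Fin n))
      rw [Fintype.card_fin] at this
      exact_mod_cast this
    calc -(n * T) ≤ ∑ _i ∈ Sᶜ, -T := by
          rw [Finset.sum_const, nsmul_eq_mul]; nlinarith
      _ ≤ _ := by
          refine Finset.sum_le_sum fun i hi => ?_
          have h2 : Real.exp (s * inner ℝ u (Z i)) ≤ Real.exp (-((γ + δ) * s)) := by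
            rw [Real.exp_le_exp]
            nlinarith [H.gap_le i (Finset.mem_compl.1 hi)]
          have h3 : Real.exp (b i) ≤ Real.exp ‖v‖ := by
            rw [Real.exp_le_exp]
            exact (real_inner_le_norm _ _).trans
              (mul_le_of_le_one_right (norm_nonneg _) (H.norm_orthPart_le_one i))
          have h4 : Real.exp (s * inner ℝ u (Z i)) * Real.exp (b i) ≤ T :=
            mul_le_mul h2 h3 (Real.exp_pos _).le (Real.exp_pos _).le
          have h5 := mul_le_mul_of_nonneg_left (hconv i) (Real.exp_pos (s * inner ℝ u (Z i))).le
          have h6 := mul_pos (Real.exp_pos (s * inner ℝ u (Z i))) (Real.exp_pos (a i))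
          linarith
  have hE2 := H.exp_le_expSum w
  rw [h1, le_div_iff₀ hEpos, ← Finset.sum_add_sum_compl S]
  have hfac : n * (Real.exp (-((γ + δ) * s)) * Real.exp ‖v‖) =
      n * Real.exp (2 * ‖v‖) * Real.exp (-(δ * s)) * (Real.exp (-(γ * s)) * Real.exp (-‖v‖)) := by
    rw [show Real.exp (-((γ + δ) * s)) * Real.exp ‖v‖ = Real.exp (2 * ‖v‖) * Real.exp (-(δ * s)) *
      (Real.exp (-(γ * s)) * Real.exp (-‖v‖)) by
        simp only [← Real.exp_add]; congr 1; ring]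
    ring
  have h7 : n * (Real.exp (-((γ + δ) * s)) * Real.exp ‖v‖) ≤
      n * Real.exp (2 * ‖v‖) * Real.exp (-(δ * s)) * E := by
    rw [hfac]; gcongr
  linarith

lemma biasPotential_step_le (H : SupportCertificate Z u v γ δ S) {w : Vec d}
    (hs : 0 ≤ inner ℝ w u) {h : ℝ} (h0 : 0 ≤ h) (h1 : h ≤ 1) :
    biasPotential Z u v γ δ (w - h • softMean Z w) ≤ biasPotential Z u v γ δ w := by
  have hen := H.energy_step_le w h0 h1
  have hin := H.inner_orthPart_softMean_ge hs
  have hsq : ‖orthPart u (w - h • softMean Z w) - v‖ ^ 2 = ‖orthPart u w - v‖ ^ 2 -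
      2 * (h * inner ℝ (orthPart u w - v) (orthPart u (softMean Z w))) +
        h ^ 2 * ‖orthPart u (softMean Z w)‖ ^ 2 := by
    rw [orthPart_sub, orthPart_smul, sub_right_comm, norm_sub_sq_real, inner_smul_right,
      norm_smul, mul_pow, Real.norm_eq_abs, sq_abs]
  have hs' : inner ℝ w u + h * γ ≤ inner ℝ (w - h • softMean Z w) u := by
    rw [inner_sub_left, inner_smul_left, conj_trivial]
    have := mul_le_mul_of_nonneg_left (H.inner_softMean_le w) h0
    linarith
  unfold biasPotential
  set s := inner ℝ w u
  set s' := inner ℝ (w - h • softMean Z w) u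
  set p := ‖orthPart u (softMean Z w)‖
  set r := ‖v‖
  have hδ := H.gap_pos
  have hγ := H.pos
  have hc : 0 < δ * γ := mul_pos hδ hγ
  have hexp : Real.exp (-(δ * s')) ≤ Real.exp (-(δ * s)) * Real.exp (-(δ * γ * h)) := by
    rw [← Real.exp_add, Real.exp_le_exp]
    nlinarith
  have hM : gapConst γ δ r * (δ * γ * h * Real.exp (-(δ * γ))) = Real.exp (2 * r) * h := by
    rw [gapConst, Real.exp_neg]
    field_simp
  have hdec : gapConst γ δ r * (n * Real.exp (-(δ * s'))) + h * (n * Real.exp (2 * r) *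
      Real.exp (-(δ * s))) ≤ gapConst γ δ r * (n * Real.exp (-(δ * s))) := by
    have hMpos := gapConst_pos hγ hδ r
    have h2 : gapConst γ δ r * (n * Real.exp (-(δ * s'))) ≤ gapConst γ δ r *
        (n * (Real.exp (-(δ * s)) * Real.exp (-(δ * γ * h)))) := by gcongr
    have h3 := mul_le_mul_of_nonneg_left (mul_exp_neg_le_one_sub hc.le h0 h1) hMpos.le
    rw [hM] at h3
    have h4 := mul_le_mul_of_nonneg_left h3
      (mul_nonneg (Nat.cast_nonneg (α := ℝ) n) (Real.exp_pos (-(δ * s))).le)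
    linarith
  have h5 : h ^ 2 * p ^ 2 ≤ h * p ^ 2 := by
    gcongr
    nlinarith
  have h6 := mul_le_mul_of_nonneg_left hin h0
  rw [hsq]
  linarith

/-- Until the length along `u` reaches `ln n / δ`, the iterates have norm `O(ln n)`; from then on
the potential stays bounded. -/
lemma iterate_dichotomy (H : SupportCertificate Z u v γ δ S)
    (h0 : ∀ t, 0 ≤ normStep Z η t) (h1 : ∀ t, normStep Z η t ≤ 1) (t : ℕ) :
    inner ℝ (iterate Z η t) u ≤ Real.log n / δ ∨
      biasPotential Z u v γ δ (iterate Z η t) ≤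
        (‖v‖ + Real.log n / (δ * γ) + 1) ^ 2 + 2 * Real.log n + 2 * gapConst γ δ ‖v‖ := by
  have hδ := H.gap_pos
  have hγ := H.pos
  have hn : (0 : ℝ) < n := by exact_mod_cast H.card_pos
  have hA0 : ∀ t, 0 ≤ totalStep Z η t := fun t => Finset.sum_nonneg fun j _ => h0 j
  have hs0 : ∀ t, 0 ≤ inner ℝ (iterate Z η t) u := fun t =>
    (mul_nonneg hγ.le (hA0 t)).trans (H.mul_totalStep_le_inner h0 t)
  induction t with
  | zero =>
    left
    have : 0 ≤ Real.log n := Real.log_natCast_nonneg n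
    simp only [iterate, inner_zero_left]
    positivity
  | succ t ih =>
    rcases ih with ih | ih
    · by_cases hs : inner ℝ (iterate Z η (t + 1)) u ≤ Real.log n / δ
      · exact Or.inl hs
      right
      push Not at hs
      have h2 : ‖iterate Z η (t + 1)‖ ≤ Real.log n / (δ * γ) + 1 := by
        have h3 := norm_iterate_le H.card_pos H.norm_le h0 (t + 1)
        have h4 := (H.mul_totalStep_le_inner h0 t).trans ih
        have h5 : totalStep Z η t ≤ Real.log n / (δ * γ) := by
          rw [le_div_iff₀ (by positivity)]
          rw [le_div_iff₀ hδ] at h4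
          linarith
        rw [totalStep_succ] at h3
        linarith [h1 t]
      have h6 : ‖orthPart u (iterate Z η (t + 1)) - v‖ ≤ ‖v‖ + Real.log n / (δ * γ) + 1 := by
        have := norm_sub_le (orthPart u (iterate Z η (t + 1))) v
        have := norm_orthPart_le H.unit (iterate Z η (t + 1))
        linarith
      have h7 : n * Real.exp (-(δ * inner ℝ (iterate Z η (t + 1)) u)) ≤ 1 := by
        rw [div_lt_iff₀ hδ] at hs
        calc n * Real.exp (-(δ * inner ℝ (iterate Z η (t + 1)) u))
            ≤ n * Real.exp (-Real.log n) := by gcongr; linarith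
          _ = 1 := by rw [Real.exp_neg, Real.exp_log hn]; exact mul_inv_cancel₀ hn.ne'
      have h8 := H.energy_iterate_le h0 h1 (t + 1)
      have h9 := mul_le_mul_of_nonneg_left h7 (gapConst_pos hγ hδ ‖v‖).le
      have h10 := pow_le_pow_left₀ (norm_nonneg _) h6 2
      unfold biasPotential
      linarith
    · right
      rw [iterate_succ H.card_pos]
      exact (H.biasPotential_step_le (hs0 t) (h0 t) (h1 t)).trans ih

/-- The orthogonal component of the iterates is `O(ln n)`. -/
lemma norm_orthPart_iterate_le (H : SupportCertificate Z u v γ δ S) (hn2 : 2 ≤ n)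
    (h0 : ∀ t, 0 ≤ normStep Z η t) (h1 : ∀ t, normStep Z η t ≤ 1) (t : ℕ) :
    ‖orthPart u (iterate Z η t)‖ ≤ biasConst γ δ ‖v‖ * Real.log n := by
  have hδ := H.gap_pos
  have hγ := H.pos
  have hc : 0 < 1 / (δ * γ) := by positivity
  have hM := gapConst_pos hγ hδ ‖v‖
  set ℓ := Real.log n with hℓ
  have hℓ1 : 1 ≤ 2 * ℓ := by
    have : Real.log 2 ≤ ℓ := Real.log_le_log (by norm_num) (by exact_mod_cast hn2)
    linarith [Real.log_two_gt_d9]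
  have hℓ0 : 0 < ℓ := by linarith
  have hr := norm_nonneg v
  set Q := (2 * ‖v‖ + 1 / (δ * γ) + 2) ^ 2 + 4 + 8 * gapConst γ δ ‖v‖ with hQ
  have hdiv : ℓ / (δ * γ) = 1 / (δ * γ) * ℓ := by ring
  rcases H.iterate_dichotomy h0 h1 t with hs | hB
  · have h2 : totalStep Z η t ≤ 1 / (δ * γ) * ℓ := by
      have h4 := (H.mul_totalStep_le_inner h0 t).trans hs
      rw [← hdiv, le_div_iff₀ (by positivity)]
      rw [le_div_iff₀ hδ] at h4
      linarith
    have h3 : 1 / (δ * γ) ≤ Real.sqrt Q := Real.le_sqrt_of_sq_le (by nlinarith)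
    calc ‖orthPart u (iterate Z η t)‖ ≤ 1 / (δ * γ) * ℓ :=
          (norm_orthPart_le H.unit _).trans ((norm_iterate_le H.card_pos H.norm_le h0 t).trans h2)
      _ ≤ biasConst γ δ ‖v‖ * ℓ := by
          gcongr
          rw [biasConst]; linarith
  · have hD : ‖orthPart u (iterate Z η t) - v‖ ^ 2 ≤ Q * ℓ ^ 2 := by
      have h2 := H.energy_nonneg (iterate Z η t)
      have h3 : 0 ≤ gapConst γ δ ‖v‖ *
          (n * Real.exp (-(δ * inner ℝ (iterate Z η t) u))) := by positivity
      unfold biasPotential at hB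
      have h4 : (‖v‖ + ℓ / (δ * γ) + 1) ^ 2 ≤ ((2 * ‖v‖ + 1 / (δ * γ) + 2) * ℓ) ^ 2 := by
        rw [hdiv]
        have : ‖v‖ ≤ ‖v‖ * (2 * ℓ) := le_mul_of_one_le_right hr hℓ1
        gcongr
        linarith
      have h5 : 1 ≤ 4 * ℓ ^ 2 := by nlinarith
      have h6 : 2 * ℓ ≤ 4 * ℓ ^ 2 := by nlinarith
      have h7 : gapConst γ δ ‖v‖ ≤ gapConst γ δ ‖v‖ * (4 * ℓ ^ 2) := le_mul_of_one_le_right hM.le h5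
      rw [hQ]
      nlinarith
    have hQ0 : 0 ≤ Q := by positivity
    have h8 : ‖orthPart u (iterate Z η t) - v‖ ≤ Real.sqrt Q * ℓ := by
      have := Real.le_sqrt_of_sq_le hD
      rwa [Real.sqrt_mul hQ0, Real.sqrt_sq hℓ0.le] at this
    have h9 := norm_le_norm_sub_add (orthPart u (iterate Z η t)) v
    have h10 : ‖v‖ ≤ ‖v‖ * (2 * ℓ) := le_mul_of_one_le_right hr hℓ1
    rw [biasConst]
    linarith

/-- The distance to the maximum margin direction is `O(ln n / ∑ η̂_j)`. -/
lemma directionError_le (H : SupportCertificate Z u v γ δ S) (h0 : ∀ t, 0 < normStep Z η t)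
    (h1 : ∀ t, normStep Z η t ≤ 1) {t : ℕ} (ht : 1 ≤ t) :
    directionError Z η u t ≤ 2 * biasConst γ δ ‖v‖ / γ * Real.log n / totalStep Z η t := by
  have h0' := fun t => (h0 t).le
  have hA : 0 < totalStep Z η t :=
    Finset.sum_pos (fun j _ => h0 j) (Finset.nonempty_range_iff.2 (by omega))
  have hγ := H.pos
  have hs := H.mul_totalStep_le_inner h0' t
  have hs0 : 0 < inner ℝ (iterate Z η t) u := (mul_pos hγ hA).trans_le hs
  have hw : γ * totalStep Z η t ≤ ‖iterate Z η t‖ := by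
    have := real_inner_le_norm (iterate Z η t) u
    rw [H.unit, mul_one] at this
    exact hs.trans this
  have hv : ‖orthPart u (iterate Z η t)‖ ≤ biasConst γ δ ‖v‖ * Real.log n := by
    rcases (show 1 ≤ n from H.card_pos).eq_or_lt with h | h
    · subst h
      simp [H.toMarginCertificate.orthPart_iterate_eq_zero h0' h1 t]
    · exact H.norm_orthPart_iterate_le h h0' h1 t
  calc directionError Z η u t ≤ 2 * ‖orthPart u (iterate Z η t)‖ / ‖iterate Z η t‖ :=
        norm_normalize_sub_le H.unit hs0
    _ ≤ 2 * (biasConst γ δ ‖v‖ * Real.log n) / (γ * totalStep Z η t) := by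
        have := (norm_nonneg _).trans hv
        exact div_le_div₀ (by linarith) (by linarith) (by positivity) hw
    _ = _ := by field_simp

end SupportCertificate

/-! ### Existence and uniqueness of the maximum margin direction -/

namespace MarginCertificate

variable {Z : Fin n → Vec d} {u : Vec d} {γ : ℝ}

lemma margin_le_mul_inner (H : MarginCertificate Z u γ) (u' : Vec d) :
    margin Z u' ≤ γ * inner ℝ u' u := by
  obtain ⟨q, hq, hq1, hqz⟩ := H.dual
  have h2 : ∑ i, q i * inner ℝ u' (-(Z i)) = γ * inner ℝ u' u := by
    rw [← inner_smul_right, ← neg_neg (γ • u), ← hqz, inner_neg_right, inner_sum]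
    simp [inner_smul_right]
  calc margin Z u' = ∑ i, q i * margin Z u' := by rw [← Finset.sum_mul, hq1, one_mul]
    _ ≤ ∑ i, q i * inner ℝ u' (-(Z i)) := Finset.sum_le_sum fun i _ =>
        mul_le_mul_of_nonneg_left (ciInf_le (Set.finite_range _).bddBelow i) (hq i)
    _ = _ := h2

lemma margin_eq (H : MarginCertificate Z u γ) : margin Z u = γ := by
  have : Nonempty (Fin n) := ⟨⟨0, H.card_pos⟩⟩
  refine le_antisymm ?_ (le_ciInf fun i => ?_)
  · simpa [H.unit] using H.margin_le_mul_inner u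
  · rw [inner_neg_right]; linarith [H.margin_le i]

lemma isMaxMarginDirection_iff (H : MarginCertificate Z u γ) (u' : Vec d) :
    IsMaxMarginDirection Z u' ↔ u' = u := by
  constructor
  · rintro ⟨h1, h2⟩
    have h3 := h2 u H.unit
    rw [H.margin_eq] at h3
    have h4 : 1 ≤ inner ℝ u' u := by
      have := H.margin_le_mul_inner u'
      nlinarith [H.pos]
    have h5 := real_inner_le_norm u' u
    rw [h1, H.unit, one_mul] at h5
    exact (inner_eq_one_iff_of_norm_eq_one h1 H.unit).1 (le_antisymm h5 h4)
  · rintro rfl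
    refine ⟨H.unit, fun w hw => ?_⟩
    rw [H.margin_eq]
    have h5 := real_inner_le_norm w u'
    rw [hw, H.unit, one_mul] at h5
    exact (H.margin_le_mul_inner w).trans (mul_le_of_le_one_right H.pos.le h5)

lemma mem_supportIndices_iff (H : MarginCertificate Z u γ) (i : Fin n) :
    i ∈ supportIndices Z u ↔ inner ℝ u (Z i) = -γ := by
  rw [supportIndices, Set.mem_ofPred, H.margin_eq, inner_neg_right, neg_eq_iff_eq_neg]

end MarginCertificate

/-- The point of smallest norm in the convex hull of the data, with its optimality condition. -/
lemma exists_minNorm_weights (hn : 0 < n) (Z : Fin n → Vec d) :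
    ∃ q ∈ stdSimplex ℝ (Fin n), ∀ j,
      ‖∑ i, q i • Z i‖ ^ 2 ≤ inner ℝ (∑ i, q i • Z i) (Z j) := by
  have : Nonempty (Fin n) := ⟨⟨0, hn⟩⟩
  let T : (Fin n → ℝ) →ₗ[ℝ] Vec d := Fintype.linearCombination ℝ Z
  have hT : ∀ q, T q = ∑ i, q i • Z i := fun q => Fintype.linearCombination_apply ℝ Z q
  have hconv : Convex ℝ (T '' stdSimplex ℝ (Fin n)) := (convex_stdSimplex ℝ _).linear_image T
  have hcomp : IsCompact (T '' stdSimplex ℝ (Fin n)) :=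
    (isCompact_stdSimplex ℝ _).image T.continuous_of_finiteDimensional
  have hne : (T '' stdSimplex ℝ (Fin n)).Nonempty :=
    ⟨_, _, single_mem_stdSimplex ℝ (⟨0, hn⟩ : Fin n), rfl⟩
  obtain ⟨c, hc, hmin⟩ := exists_norm_eq_iInf_of_complete_convex hne hcomp.isComplete hconv 0
  have hvar := (norm_eq_iInf_iff_real_inner_le_zero hconv hc).1 hmin
  obtain ⟨q, hq, rfl⟩ := hc
  refine ⟨q, hq, fun j => ?_⟩
  rw [← hT]
  have hj : Z j ∈ T '' stdSimplex ℝ (Fin n) :=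
    ⟨Pi.single j 1, single_mem_stdSimplex ℝ j, by simp [T]⟩
  have := hvar _ hj
  rw [zero_sub, inner_neg_left, inner_sub_right, real_inner_self_eq_norm_sq] at this
  linarith

/-- Strong duality: the maximum margin of separable data is the distance of their convex hull
from the origin. -/
lemma exists_marginCertificate (hn : 0 < n) {Z : Fin n → Vec d} (hZ : ∀ i, ‖Z i‖ ≤ 1)
    (hsep : Separable Z) : ∃ u γ, MarginCertificate Z u γ := by
  obtain ⟨q, ⟨hq0, hq1⟩, hq⟩ := exists_minNorm_weights hn Z
  set c := ∑ i, q i • Z i with hc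
  have hc0 : c ≠ 0 := by
    obtain ⟨w, hw⟩ := hsep
    intro h
    have h1 : ∑ i, q i * inner ℝ w (-(Z i)) = 0 := by
      have : inner ℝ w c = 0 := by rw [h, inner_zero_right]
      rw [hc, inner_sum] at this
      simpa [inner_smul_right] using this
    have h2 := (Finset.sum_eq_zero_iff_of_nonneg
      fun i _ => mul_nonneg (hq0 i) (hw i).le).1 h1
    have h3 : ∀ i, q i = 0 := fun i =>
      (mul_eq_zero.1 (h2 i (Finset.mem_univ i))).resolve_right (hw i).ne'
    simp [h3] at hq1
  have hpos : 0 < ‖c‖ := norm_pos_iff.2 hc0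
  refine ⟨-(‖c‖⁻¹ • c), ‖c‖, hn, hZ, ?_, hpos, fun i => ?_, q, hq0, hq1, ?_⟩
  · rw [norm_neg, norm_smul, norm_inv, norm_norm, inv_mul_cancel₀ hpos.ne']
  · rw [inner_neg_left, inner_smul_left, conj_trivial, neg_le_neg_iff, ← div_eq_inv_mul,
      le_div_iff₀ hpos, ← sq]
    exact hq i
  · rw [smul_neg, neg_neg, smul_smul, mul_inv_cancel₀ hpos.ne', one_smul]

/-! ### Generic data have positive dual weights on the support -/

/-- Datasets for which an optimal dual weight of the support vector `z_i` vanishes, while the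
optimal convex combination has norm at least `ε`. -/
def degenerateData (n d : ℕ) (i : Fin n) (ε : ℝ) : Set (Fin n → Vec d) :=
  {Z | ∃ q ∈ stdSimplex ℝ (Fin n), q i = 0 ∧ ε ≤ ‖∑ j, q j • Z j‖ ∧
    (∀ k, ‖∑ j, q j • Z j‖ ^ 2 ≤ inner ℝ (∑ j, q j • Z j) (Z k)) ∧
    inner ℝ (∑ j, q j • Z j) (Z i) = ‖∑ j, q j • Z j‖ ^ 2}

lemma isClosed_degenerateData (i : Fin n) (ε : ℝ) : IsClosed (degenerateData n d i ε) := by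
  have h : degenerateData n d i ε = Prod.snd '' {p : stdSimplex ℝ (Fin n) × (Fin n → Vec d) |
      p.1.1 i = 0 ∧ ε ≤ ‖∑ j, p.1.1 j • p.2 j‖ ∧
      (∀ k, ‖∑ j, p.1.1 j • p.2 j‖ ^ 2 ≤ inner ℝ (∑ j, p.1.1 j • p.2 j) (p.2 k)) ∧
      inner ℝ (∑ j, p.1.1 j • p.2 j) (p.2 i) = ‖∑ j, p.1.1 j • p.2 j‖ ^ 2} := by
    ext Z
    constructor
    · rintro ⟨q, hq, h⟩
      exact ⟨(⟨q, hq⟩, Z), h, rfl⟩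
    · rintro ⟨⟨⟨q, hq⟩, Z'⟩, h, rfl⟩
      exact ⟨q, hq, h⟩
  have : CompactSpace (stdSimplex ℝ (Fin n)) :=
    isCompact_iff_compactSpace.1 (isCompact_stdSimplex ℝ (Fin n))
  rw [h]
  refine isClosedMap_snd_of_compactSpace _ ?_
  have hq : ∀ j, Continuous fun p : stdSimplex ℝ (Fin n) × (Fin n → Vec d) => p.1.1 j := fun j =>
    (continuous_apply j).comp (continuous_subtype_val.comp continuous_fst)
  have hZ : ∀ j, Continuous fun p : stdSimplex ℝ (Fin n) × (Fin n → Vec d) => p.2 j := fun j =>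
    (continuous_apply j).comp continuous_snd
  have hc : Continuous fun p : stdSimplex ℝ (Fin n) × (Fin n → Vec d) =>
      ∑ j, p.1.1 j • p.2 j := continuous_finsetSum _ fun j _ => (hq j).smul (hZ j)
  refine (isClosed_eq (hq i) continuous_const).inter
    ((isClosed_le continuous_const hc.norm).inter (IsClosed.inter ?_
      (isClosed_eq (hc.inner (hZ i)) (hc.norm.pow 2))))
  have : {p : stdSimplex ℝ (Fin n) × (Fin n → Vec d) |
      ∀ k, ‖∑ j, p.1.1 j • p.2 j‖ ^ 2 ≤ inner ℝ (∑ j, p.1.1 j • p.2 j) (p.2 k)} =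
      ⋂ k, {p | ‖∑ j, p.1.1 j • p.2 j‖ ^ 2 ≤ inner ℝ (∑ j, p.1.1 j • p.2 j) (p.2 k)} := by
    ext; simp
  change IsClosed {p : stdSimplex ℝ (Fin n) × (Fin n → Vec d) |
      ∀ k, ‖∑ j, p.1.1 j • p.2 j‖ ^ 2 ≤ inner ℝ (∑ j, p.1.1 j • p.2 j) (p.2 k)}
  rw [this]
  exact isClosed_iInter fun k => isClosed_le (hc.norm.pow 2) (hc.inner (hZ k))

lemma volume_hyperplane_eq_zero {c : Vec d} (hc : c ≠ 0) (b : ℝ) :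
    volume {x : Vec d | inner ℝ c x = b} = 0 := by
  have hcc : inner ℝ c c ≠ 0 := inner_self_ne_zero.2 hc
  set p : Vec d := (b / inner ℝ c c) • c
  have hp : inner ℝ c p = b := by
    rw [inner_smul_right]; field_simp
  have h : {x : Vec d | inner ℝ c x = b} =
      (AffineSubspace.mk' p (innerSL ℝ c).toLinearMap.ker : Set (Vec d)) := by
    ext x
    simp [AffineSubspace.mem_mk', inner_sub_right, hp, sub_eq_zero]
  rw [h]
  refine Measure.addHaar_affineSubspace _ _ fun htop => hc ?_
  have h1 : p + c ∈ (AffineSubspace.mk' p (innerSL ℝ c).toLinearMap.ker) := by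
    rw [htop]; trivial
  simpa [AffineSubspace.mem_mk'] using h1

/-- For fixed `z_j` with `j ≠ i`, a degenerate `z_i` lies on the hyperplane determined by the
point of smallest norm in the convex hull of the other vectors. -/
lemma volume_degenerateData (i : Fin n) {ε : ℝ} (hε : 0 < ε) :
    volume (degenerateData n d i ε) = 0 := by
  obtain _ | m := n
  · exact i.elim0
  have hmeas := (isClosed_degenerateData (d := d) i ε).measurableSet
  have hpres := (volume_preserving_piFinSuccAbove (fun _ : Fin (m + 1) => Vec d) i).symm
  rw [← hpres.measure_preimage hmeas.nullMeasurableSet, Measure.volume_eq_prod,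
    Measure.prod_apply_symm (hpres.measurable hmeas), lintegral_eq_zero_of_ae_eq_zero]
  refine ae_of_all _ fun Y => ?_
  set A := (fun x : Vec d => (x, Y)) ⁻¹'
    ((MeasurableEquiv.piFinSuccAbove (fun _ : Fin (m + 1) => Vec d) i).symm ⁻¹'
      degenerateData (m + 1) d i ε) with hA
  have hmem : ∀ x ∈ A, ∃ q ∈ stdSimplex ℝ (Fin (m + 1)), q i = 0 ∧
      ε ≤ ‖∑ j, q (i.succAbove j) • Y j‖ ∧
      (∀ k, ‖∑ j, q (i.succAbove j) • Y j‖ ^ 2 ≤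
        inner ℝ (∑ j, q (i.succAbove j) • Y j) (Y k)) ∧
      inner ℝ (∑ j, q (i.succAbove j) • Y j) x = ‖∑ j, q (i.succAbove j) • Y j‖ ^ 2 := by
    intro x hx
    have hx' : i.insertNth x Y ∈ degenerateData (m + 1) d i ε := hx
    obtain ⟨q, hq, hqi, h1, h2, h3⟩ := hx'
    have hsum : ∑ j, q j • (i.insertNth x Y : Fin (m + 1) → Vec d) j =
        ∑ j, q (i.succAbove j) • Y j := by
      rw [Fin.sum_univ_succAbove _ i, hqi, zero_smul, zero_add]
      simp
    rw [hsum] at h1 h2 h3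
    refine ⟨q, hq, hqi, h1, fun k => ?_, ?_⟩
    · simpa using h2 (i.succAbove k)
    · simpa using h3
  rcases A.eq_empty_or_nonempty with hE | ⟨x₀, hx₀⟩
  · change volume A = 0
    rw [hE, measure_empty]
  obtain ⟨q₀, hq₀, hqi₀, h1, h2, -⟩ := hmem x₀ hx₀
  set c := ∑ j, q₀ (i.succAbove j) • Y j with hc
  have hc0 : c ≠ 0 := norm_pos_iff.1 (hε.trans_le h1)
  refine measure_mono_null (fun x hx => ?_) (volume_hyperplane_eq_zero hc0 (‖c‖ ^ 2))
  obtain ⟨q, hq, hqi, -, h4, h5⟩ := hmem x hx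
  set c' := ∑ j, q (i.succAbove j) • Y j with hc'
  -- A point of a convex set with the optimality condition is the unique point of smallest norm.
  have hinner : ∀ (q : Fin (m + 1) → ℝ), q ∈ stdSimplex ℝ (Fin (m + 1)) → q i = 0 → ∀ a : Vec d,
      (∀ k, ‖a‖ ^ 2 ≤ inner ℝ a (Y k)) →
        ‖a‖ ^ 2 ≤ inner ℝ a (∑ j, q (i.succAbove j) • Y j) := by
    rintro q ⟨hq0, hq1⟩ hqi a ha
    rw [Fin.sum_univ_succAbove _ i, hqi, zero_add] at hq1
    calc ‖a‖ ^ 2 = ∑ j, q (i.succAbove j) * ‖a‖ ^ 2 := by rw [← Finset.sum_mul, hq1, one_mul]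
      _ ≤ ∑ j, q (i.succAbove j) * inner ℝ a (Y j) :=
          Finset.sum_le_sum fun j _ => mul_le_mul_of_nonneg_left (ha j) (hq0 _)
      _ = _ := by simp [inner_sum, inner_smul_right]
  have h6 := hinner q hq hqi c h2
  have h7 := hinner q₀ hq₀ hqi₀ c' h4
  have h8 : c = c' := by
    have h9 := norm_sub_sq_real c c'
    rw [← hc'] at h6
    rw [← hc, real_inner_comm] at h7
    rw [← sub_eq_zero, ← norm_eq_zero]
    nlinarith [sq_nonneg ‖c - c'‖]
  rw [← h8] at h5
  exact h5

/-- For almost every dataset all support vectors have positive dual weights. -/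
lemma ae_dual_weights_pos (n d : ℕ) : ∀ᵐ Z : Fin n → Vec d, ∀ (u : Vec d) (γ : ℝ),
    MarginCertificate Z u γ → ∀ q : Fin n → ℝ, (∀ i, 0 ≤ q i) → ∑ i, q i = 1 →
      ∑ i, q i • Z i = -(γ • u) → ∀ i, inner ℝ u (Z i) = -γ → 0 < q i := by
  have h : ∀ᵐ Z : Fin n → Vec d, ∀ (i : Fin n) (k : ℕ), Z ∉ degenerateData n d i (1 / (k + 1)) :=
    ae_all_iff.2 fun i => ae_all_iff.2 fun k =>
      measure_eq_zero_iff_ae_notMem.1 (volume_degenerateData i Nat.one_div_pos_of_nat)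
  filter_upwards [h] with Z hZ u γ H q hq0 hq1 hqz i hi
  refine lt_of_le_of_ne (hq0 i) fun hqi => ?_
  obtain ⟨k, hk⟩ := exists_nat_one_div_lt H.pos
  have hnorm : ‖-(γ • u)‖ = γ := by
    rw [norm_neg, norm_smul, H.unit, mul_one, Real.norm_of_nonneg H.pos.le]
  refine hZ i k ⟨q, ⟨hq0, hq1⟩, hqi.symm, ?_, fun j => ?_, ?_⟩ <;> rw [hqz, hnorm]
  · exact hk.le
  · rw [inner_neg_left, inner_smul_left, conj_trivial]
    nlinarith [H.margin_le j, H.pos]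
  · rw [inner_neg_left, inner_smul_left, conj_trivial, hi]
    ring

/-! ### The minimizer of the orthogonal risk -/

lemma eq_zero_of_mem_span_of_inner_eq_zero {s : Set (Vec d)} {w : Vec d}
    (hw : w ∈ Submodule.span ℝ s) (h : ∀ y ∈ s, inner ℝ w y = 0) : w = 0 := by
  have : w ∈ (Submodule.span ℝ s)ᗮ := by
    rw [Submodule.mem_orthogonal']
    intro x hx
    induction hx using Submodule.span_induction with
    | mem x hx => exact h x hx
    | zero => simp
    | add x y _ _ hx hy => rw [inner_add_right, hx, hy, add_zero]
    | smul a x _ hx => rw [inner_smul_right, hx, mul_zero]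
  exact inner_self_eq_zero.1 ((Submodule.mem_orthogonal' _ _).1 this w hw)

/-- A sum of exponentials of linear forms with a vanishing positive combination attains its
minimum, and does so on the span of the forms: on this span it is coercive, because an upper bound
for all forms gives a lower bound for each of them. -/
lemma exists_forall_sum_exp_le (S : Finset (Fin n)) (y : Fin n → Vec d) {q : Fin n → ℝ}
    (hq : ∀ i ∈ S, 0 < q i) (hqy : ∑ i ∈ S, q i • y i = 0) :
    ∃ v ∈ Submodule.span ℝ (y '' S), ∀ w : Vec d,
      ∑ i ∈ S, Real.exp (inner ℝ v (y i)) ≤ ∑ i ∈ S, Real.exp (inner ℝ w (y i)) := by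
  set V := Submodule.span ℝ (y '' S) with hV
  let f : Vec d → ℝ := fun w => ∑ i ∈ S, Real.exp (inner ℝ w (y i))
  let T : V →ₗ[ℝ] (S → ℝ) :=
    LinearMap.pi fun i => (innerSL ℝ (y i)).toLinearMap ∘ₗ V.subtype
  have hT : ∀ (w : V) (i : S), T w i = inner ℝ (w : Vec d) (y i) := fun w i => by
    simp [T, real_inner_comm]
  have hker : T.ker = ⊥ := by
    rw [LinearMap.ker_eq_bot']
    intro w hw
    refine Subtype.ext (eq_zero_of_mem_span_of_inner_eq_zero w.2 ?_)
    rintro _ ⟨i, hi, rfl⟩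
    rw [← hT w ⟨i, hi⟩, hw]; rfl
  obtain ⟨K, -, hK⟩ := T.exists_antilipschitzWith hker
  set N : ℝ := f 0 with hN
  have hN0 : 0 ≤ N := Finset.sum_nonneg fun _ _ => (Real.exp_pos _).le
  -- On a sublevel set each form is bounded above, hence bounded below.
  have hbound : ∀ w : V, f w ≤ N → ‖T w‖ ≤ ∑ i ∈ S, (N + (∑ j ∈ S, q j * N) / q i) := by
    intro w hw
    have hpos : ∀ i ∈ S, 0 ≤ N + (∑ j ∈ S, q j * N) / q i := fun i hi =>
      add_nonneg hN0 (div_nonneg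
        (Finset.sum_nonneg fun j hj => mul_nonneg (hq j hj).le hN0) (hq i hi).le)
    have hup : ∀ i ∈ S, inner ℝ (w : Vec d) (y i) ≤ N := fun i hi => by
      have h1 := Finset.single_le_sum (f := fun i => Real.exp (inner ℝ (w : Vec d) (y i)))
        (fun _ _ => (Real.exp_pos _).le) hi
      have h2 := Real.add_one_le_exp (inner ℝ (w : Vec d) (y i))
      have h3 : Real.exp (inner ℝ (w : Vec d) (y i)) ≤ f w := h1
      linarith
    refine (pi_norm_le_iff_of_nonneg (Finset.sum_nonneg hpos)).2 fun ⟨i, hi⟩ => ?_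
    refine le_trans ?_ (Finset.single_le_sum hpos hi)
    rw [hT, Real.norm_eq_abs, abs_le]
    have hquot : 0 ≤ (∑ j ∈ S, q j * N) / q i :=
      div_nonneg (Finset.sum_nonneg fun j hj => mul_nonneg (hq j hj).le hN0) (hq i hi).le
    refine ⟨?_, by linarith [hup i hi]⟩
    have h0 : ∑ j ∈ S, q j * inner ℝ (w : Vec d) (y j) = 0 := by
      have : inner ℝ (w : Vec d) (∑ j ∈ S, q j • y j) = 0 := by rw [hqy, inner_zero_right]
      simpa [inner_sum, inner_smul_right] using this
    have h1 : ∑ j ∈ S, q j * (N - inner ℝ (w : Vec d) (y j)) = ∑ j ∈ S, q j * N := by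
      simp [mul_sub, Finset.sum_sub_distrib, h0]
    have h2 := Finset.single_le_sum (f := fun j => q j * (N - inner ℝ (w : Vec d) (y j)))
      (fun j hj => mul_nonneg (hq j hj).le (sub_nonneg.2 (hup j hj))) hi
    rw [h1] at h2
    have h3 : N - inner ℝ (w : Vec d) (y i) ≤ (∑ j ∈ S, q j * N) / q i := by
      rw [le_div_iff₀ (hq i hi), mul_comm]; exact h2
    linarith
  have hcont : Continuous fun w : V => f w :=
    continuous_finsetSum _ fun i _ => (continuous_subtype_val.inner continuous_const).rexp
  have hcoercive : ∀ᶠ w : V in cocompact V, f (0 : V) ≤ f w := by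
    filter_upwards [(tendsto_norm_cocompact_atTop (E := V)).eventually_gt_atTop
      (K * ∑ i ∈ S, (N + (∑ j ∈ S, q j * N) / q i))] with w hw
    by_contra! hlt
    have h1 := hK.le_mul_dist w 0
    rw [map_zero, dist_zero_right, dist_zero_right] at h1
    have h2 := mul_le_mul_of_nonneg_left (hbound w hlt.le) K.coe_nonneg
    linarith
  obtain ⟨v, hv⟩ := hcont.exists_forall_le' 0 hcoercive
  refine ⟨v, v.2, fun w => ?_⟩
  obtain ⟨a, ha, b, hb, rfl⟩ := V.exists_add_mem_mem_orthogonal w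
  refine (hv ⟨a, ha⟩).trans (le_of_eq (Finset.sum_congr rfl fun i hi => ?_))
  rw [inner_add_left, (Submodule.mem_orthogonal' _ _).1 hb (y i)
    (Submodule.subset_span ⟨i, hi, rfl⟩), add_zero]

/-- Strict convexity on the span of the forms. -/
lemma eq_of_forall_sum_exp_le {S : Finset (Fin n)} {y : Fin n → Vec d} {v v' : Vec d}
    (hv : v ∈ Submodule.span ℝ (y '' S)) (hv' : v' ∈ Submodule.span ℝ (y '' S))
    (hmin : ∀ w : Vec d,
      ∑ i ∈ S, Real.exp (inner ℝ v (y i)) ≤ ∑ i ∈ S, Real.exp (inner ℝ w (y i)))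
    (hle : ∑ i ∈ S, Real.exp (inner ℝ v' (y i)) ≤ ∑ i ∈ S, Real.exp (inner ℝ v (y i))) :
    v' = v := by
  have hsq : ∀ i, (Real.exp (inner ℝ v (y i) / 2) - Real.exp (inner ℝ v' (y i) / 2)) ^ 2 =
      Real.exp (inner ℝ v (y i)) + Real.exp (inner ℝ v' (y i)) -
        2 * Real.exp (inner ℝ ((1 / 2 : ℝ) • (v + v')) (y i)) := fun i => by
    have h1 : Real.exp (inner ℝ v (y i)) = Real.exp (inner ℝ v (y i) / 2) ^ 2 := by
      rw [← Real.exp_nat_mul]; congr 1; push_cast; ring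
    have h2 : Real.exp (inner ℝ v' (y i)) = Real.exp (inner ℝ v' (y i) / 2) ^ 2 := by
      rw [← Real.exp_nat_mul]; congr 1; push_cast; ring
    have h3 : Real.exp (inner ℝ ((1 / 2 : ℝ) • (v + v')) (y i)) =
        Real.exp (inner ℝ v (y i) / 2) * Real.exp (inner ℝ v' (y i) / 2) := by
      rw [← Real.exp_add, inner_smul_left, inner_add_left, conj_trivial]; congr 1; ring
    rw [h1, h2, h3]; ring
  have hzero : ∑ i ∈ S, (Real.exp (inner ℝ v (y i) / 2) -
      Real.exp (inner ℝ v' (y i) / 2)) ^ 2 = 0 := by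
    refine le_antisymm ?_ (Finset.sum_nonneg fun _ _ => sq_nonneg _)
    simp only [hsq, Finset.sum_sub_distrib, Finset.sum_add_distrib, ← Finset.mul_sum]
    linarith [hmin ((1 / 2 : ℝ) • (v + v'))]
  have heach := (Finset.sum_eq_zero_iff_of_nonneg fun _ _ => sq_nonneg _).1 hzero
  refine sub_eq_zero.1 (eq_zero_of_mem_span_of_inner_eq_zero (Submodule.sub_mem _ hv' hv) ?_)
  rintro _ ⟨i, hi, rfl⟩
  have := Real.exp_injective (sub_eq_zero.1 (pow_eq_zero_iff two_ne_zero |>.1 (heach i hi)))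
  rw [inner_sub_left]; linarith

/-- The gap between the support vectors and the others as a real number; any positive number
serves if there are no others. -/
def gapWidth (g : ℝ≥0∞) : ℝ := if g = ∞ then 1 else g.toReal

open Classical in
/-- If the dual weights are positive on the support, the orthogonal risk has a unique minimizer, and
it yields a `SupportCertificate`. -/
lemma MarginCertificate.exists_supportCertificate {Z : Fin n → Vec d} {u : Vec d} {γ : ℝ}
    (H : MarginCertificate Z u γ)
    (hpos : ∀ q : Fin n → ℝ, (∀ i, 0 ≤ q i) → ∑ i, q i = 1 →
      ∑ i, q i • Z i = -(γ • u) → ∀ i, inner ℝ u (Z i) = -γ → 0 < q i) :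
    ∃ v, (∀ v', IsOrthMinimizer Z u v' ↔ v' = v) ∧
      SupportCertificate Z u v γ (gapWidth (supportGap Z u))
        (Finset.univ.filter (· ∈ supportIndices Z u)) := by
  set S : Finset (Fin n) := Finset.univ.filter (· ∈ supportIndices Z u) with hS
  have hmem : ∀ i, i ∈ S ↔ inner ℝ u (Z i) = -γ := fun i => by
    rw [hS, Finset.mem_filter, H.mem_supportIndices_iff]; simp
  have hcoe : (S : Set (Fin n)) = supportIndices Z u := by ext i; simp [hS]
  have hn : (0 : ℝ) < n := by exact_mod_cast H.card_pos
  obtain ⟨q, hq0, hq1, hqz⟩ := H.dual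
  -- Complementary slackness.
  have hoff : ∀ i ∉ S, q i = 0 := by
    have h1 : ∑ i, q i * (-γ - inner ℝ u (Z i)) = 0 := by
      have h2 : inner ℝ u (∑ i, q i • Z i) = -γ := by
        rw [hqz, inner_neg_right, inner_smul_right, real_inner_self_eq_norm_sq, H.unit]; ring
      simp only [inner_sum, inner_smul_right] at h2
      simp only [mul_sub, Finset.sum_sub_distrib, ← Finset.sum_mul, hq1, h2]
      ring
    have h3 := (Finset.sum_eq_zero_iff_of_nonneg fun i _ =>
      mul_nonneg (hq0 i) (sub_nonneg.2 (H.margin_le i))).1 h1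
    intro i hi
    refine (mul_eq_zero.1 (h3 i (Finset.mem_univ i))).resolve_right fun h => hi ?_
    rw [hmem]; linarith
  have hne : S.Nonempty := by
    by_contra! h
    have : ∀ i, q i = 0 := fun i => hoff i (by simp [h])
    simp [this] at hq1
  have hperp : ∑ i ∈ S, q i • orthPart u (Z i) = 0 := by
    have h1 : ∑ i, q i • orthPart u (Z i) = 0 := by
      simp only [← orthPart_smul]
      rw [← orthPart_sum, hqz]
      simp [orthPart, inner_neg_left, inner_smul_left, H.unit]
    rw [← h1]
    exact Finset.sum_subset (Finset.subset_univ _) fun i _ hi => by rw [hoff i hi, zero_smul]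
  obtain ⟨v, hvV, hvmin⟩ := exists_forall_sum_exp_le S (fun i => orthPart u (Z i))
    (fun i hi => hpos q hq0 hq1 hqz i ((hmem i).1 hi)) hperp
  have hrisk : ∀ w w', orthRisk Z u w ≤ orthRisk Z u w' ↔
      ∑ i ∈ S, Real.exp (inner ℝ w (orthPart u (Z i))) ≤
        ∑ i ∈ S, Real.exp (inner ℝ w' (orthPart u (Z i))) := fun w w' =>
    mul_le_mul_iff_right₀ (by positivity)
  have hgap_lt : ∀ i ∉ S, γ < -inner ℝ u (Z i) := fun i hi => by
    have h1 := H.margin_le i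
    have h2 : inner ℝ u (Z i) ≠ -γ := fun h => hi ((hmem i).2 h)
    have := lt_of_le_of_ne h1 h2
    linarith
  have hgap_le : ∀ i ∉ S, supportGap Z u ≤ ENNReal.ofReal (-inner ℝ u (Z i) - γ) := fun i hi => by
    have h1 : i ∈ (supportIndices Z u)ᶜ := by rw [← hcoe]; simpa using hi
    have h2 : supportGap Z u ≤ ENNReal.ofReal (inner ℝ u (-(Z i)) - margin Z u) := iInf₂_le i h1
    rwa [H.margin_eq, inner_neg_right] at h2
  have hgap_pos : 0 < supportGap Z u := by
    have : Nonempty (Fin n) := ⟨⟨0, H.card_pos⟩⟩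
    obtain ⟨i, hi⟩ := exists_eq_ciInf_of_finite (f := fun i => ⨅ (_ : i ∈ (supportIndices Z u)ᶜ),
      ENNReal.ofReal (inner ℝ u (-(Z i)) - margin Z u))
    rw [supportGap, ← hi]
    by_cases h : i ∈ (supportIndices Z u)ᶜ
    · have h2 : i ∉ S := by rw [← hcoe] at h; simpa using h
      simp only [h, iInf_pos, ENNReal.ofReal_pos, inner_neg_right, H.margin_eq]
      linarith [hgap_lt i h2]
    · simp [h]
  refine ⟨v, fun v' => ⟨fun h => ?_, ?_⟩, H, ?_, hne, fun i hi => (hmem i).1 hi, ?_, hvmin⟩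
  · rw [IsOrthMinimizer, ← hcoe] at h
    exact eq_of_forall_sum_exp_le hvV h.1 hvmin ((hrisk _ _).1 (h.2 v hvV))
  · rintro rfl
    rw [IsOrthMinimizer, ← hcoe]
    exact ⟨hvV, fun w _ => (hrisk _ _).2 (hvmin w)⟩
  · rw [gapWidth]
    split_ifs with h
    · exact one_pos
    · exact ENNReal.toReal_pos hgap_pos.ne' h
  · intro i hi
    have h1 := hgap_le i hi
    rw [gapWidth]
    split_ifs with h
    · rw [h] at h1
      exact absurd (top_le_iff.1 h1) ENNReal.ofReal_ne_top
    · have := ENNReal.toReal_le_of_le_ofReal (by linarith [hgap_lt i hi]) h1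
      linarith

/-! ### A dataset with slow directional convergence -/

/-- One support vector on the first axis, and `n - 1` copies of a vector with twice its margin
which has a component along the second axis. -/
def tiltedData (n : ℕ) (i : Fin n) : Vec 2 :=
  if (i : ℕ) = 0 then !₂[-1 / 5, 0] else !₂[-2 / 5, -1 / 2]

lemma inner_axis (w : Vec 2) : inner ℝ w !₂[1, 0] = w 0 := by
  simp [PiLp.inner_apply, Fin.sum_univ_two]

lemma inner_tiltedData (w : Vec 2) (i : Fin n) :
    inner ℝ w (tiltedData n i) =
      if (i : ℕ) = 0 then -(w 0 / 5) else -(w 0 / 5) - (w 0 / 5 + w 1 / 2) := by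
  rw [tiltedData]
  split_ifs <;> simp [PiLp.inner_apply, Fin.sum_univ_two] <;> ring

lemma marginCertificate_tiltedData (hn : 0 < n) :
    MarginCertificate (tiltedData n) !₂[1, 0] (1 / 5) := by
  refine ⟨hn, fun i => ?_, ?_, by norm_num, fun i => ?_, Pi.single ⟨0, hn⟩ 1, ?_, ?_, ?_⟩
  · rw [tiltedData, EuclideanSpace.norm_eq, Real.sqrt_le_iff]
    split_ifs <;> norm_num [Fin.sum_univ_two]
  · simp [EuclideanSpace.norm_eq, Fin.sum_univ_two]
  · rw [inner_tiltedData]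
    split_ifs <;> norm_num
  · exact (single_mem_stdSimplex ℝ (⟨0, hn⟩ : Fin n)).1
  · exact (single_mem_stdSimplex ℝ (⟨0, hn⟩ : Fin n)).2
  · ext k
    rw [Finset.sum_eq_single (⟨0, hn⟩ : Fin n)]
    · fin_cases k <;> norm_num [tiltedData]
    · intro i _ hi
      simp [Pi.single_eq_of_ne hi]
    · simp

/-- The softmax weight of the vectors which are not support vectors. -/
def tiltedWeight (n : ℕ) (w : Vec 2) : ℝ :=
  ∑ i with (i : Fin n).val ≠ 0, softWeight (tiltedData n) w i

lemma tiltedWeight_nonneg (hn : 0 < n) (w : Vec 2) : 0 ≤ tiltedWeight n w :=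
  Finset.sum_nonneg fun i _ => (softWeight_pos hn _ w i).le

lemma softMean_tiltedData (hn : 0 < n) (w : Vec 2) :
    softMean (tiltedData n) w 0 = -((1 + tiltedWeight n w) / 5) ∧
      softMean (tiltedData n) w 1 = -(tiltedWeight n w / 2) := by
  have h1 := sum_softWeight hn (tiltedData n) w
  rw [← Finset.sum_filter_add_sum_filter_not Finset.univ (fun i : Fin n => i.val ≠ 0)] at h1
  have h3 : 1 - tiltedWeight n w =
      ∑ i with ¬(i : Fin n).val ≠ 0, softWeight (tiltedData n) w i := by
    rw [tiltedWeight]; linarith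
  have h2 : softMean (tiltedData n) w = tiltedWeight n w • !₂[-2 / 5, -1 / 2] +
      (1 - tiltedWeight n w) • !₂[-1 / 5, 0] := by
    rw [h3, tiltedWeight, Finset.sum_smul, Finset.sum_smul, softMean,
      ← Finset.sum_filter_add_sum_filter_not Finset.univ (fun i : Fin n => i.val ≠ 0)]
    congr 1 <;> refine Finset.sum_congr rfl fun i hi => ?_ <;>
      simp only [Finset.mem_filter, Finset.mem_univ, true_and, not_not] at hi <;>
      simp [tiltedData, hi]
  rw [h2]
  constructor <;> simp <;> ring

/-- As long as the second kind of vectors has not been classified much better than the support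
vector, it carries at least half of the softmax weight. -/
lemma half_le_tiltedWeight (hn : 2 ≤ n) {w : Vec 2}
    (hw : w 0 / 5 + w 1 / 2 ≤ Real.log n - Real.log 2) : 1 / 2 ≤ tiltedWeight n w := by
  obtain ⟨m, rfl⟩ : ∃ m, n = m + 1 := ⟨n - 1, by omega⟩
  have hm : (1 : ℝ) ≤ m := by exact_mod_cast (by omega : 1 ≤ m)
  have hpos := expSum_pos (by omega) (tiltedData (m + 1)) w
  have hE : expSum (tiltedData (m + 1)) w = Real.exp (-(w 0 / 5)) +
      m * (Real.exp (-(w 0 / 5)) * Real.exp (-(w 0 / 5 + w 1 / 2))) := by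
    simp [expSum, Fin.sum_univ_succ, inner_tiltedData, sub_eq_add_neg, Real.exp_add]
  have hr : tiltedWeight (m + 1) w =
      m * (Real.exp (-(w 0 / 5)) * Real.exp (-(w 0 / 5 + w 1 / 2))) /
        expSum (tiltedData (m + 1)) w := by
    rw [tiltedWeight, Finset.sum_filter, Fin.sum_univ_succ]
    simp [softWeight, inner_tiltedData, sub_eq_add_neg, Real.exp_add]
    ring
  have h1 : 2 / ((m : ℝ) + 1) ≤ Real.exp (-(w 0 / 5 + w 1 / 2)) := by
    rw [← Real.exp_log (show (0 : ℝ) < 2 / (m + 1) by positivity), Real.exp_le_exp,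
      Real.log_div (by norm_num) (by positivity)]
    push_cast at hw
    linarith
  have h2 : 1 ≤ m * Real.exp (-(w 0 / 5 + w 1 / 2)) := by
    calc (1 : ℝ) ≤ m * (2 / (m + 1)) := by
          rw [mul_div_assoc', le_div_iff₀ (by positivity)]; linarith
      _ ≤ _ := by gcongr
  rw [hr, le_div_iff₀ hpos, hE]
  nlinarith [Real.exp_pos (-(w 0 / 5))]

section TiltedIterates

variable {η : ℕ → ℝ}

/-- While the tilted vectors carry half of the weight, the second coordinate grows faster than the
exponent `w 0 / 5 + w 1 / 2` at which their weight decays relative to the support vector. -/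
lemma tilted_dichotomy (hn : 0 < n) (h0 : ∀ t, 0 ≤ normStep (tiltedData n) η t) (t : ℕ) :
    0 ≤ iterate (tiltedData n) η t 1 ∧
    (iterate (tiltedData n) η t 0 / 5 + iterate (tiltedData n) η t 1 / 2 ≤
        iterate (tiltedData n) η t 1 ∨
      Real.log n - Real.log 2 ≤ iterate (tiltedData n) η t 1) := by
  induction t with
  | zero => simp [iterate]
  | succ t ih =>
    rw [iterate_succ hn]
    obtain ⟨hv, ih⟩ := ih
    obtain ⟨e0, e1⟩ := softMean_tiltedData hn (iterate (tiltedData n) η t)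
    simp only [PiLp.sub_apply, PiLp.smul_apply, smul_eq_mul, e0, e1]
    set w := iterate (tiltedData n) η t
    set h := normStep (tiltedData n) η t
    set r := tiltedWeight n w with hr
    have hh : 0 ≤ h := h0 t
    have hr0 : 0 ≤ r := tiltedWeight_nonneg hn w
    have hhr := mul_nonneg hh hr0
    refine ⟨by linarith, ?_⟩
    by_cases hlt : Real.log n - Real.log 2 ≤ w 1
    · right; linarith
    left
    have hn2 : 2 ≤ n := by
      by_contra! hcon
      have : n = 1 := by omega
      subst this
      apply hlt
      have := Real.log_pos one_lt_two
      simp only [Nat.cast_one, Real.log_one]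
      linarith
    have hE := ih.resolve_right hlt
    have h2 := half_le_tiltedWeight hn2 (hE.trans (not_le.1 hlt).le)
    have h3 := mul_le_mul_of_nonneg_left h2 hh
    linarith

lemma eventually_le_tilted (hn : 0 < n) (hadm : AdmissibleSteps (tiltedData n) η) :
    ∀ᶠ t in atTop, Real.log n - Real.log 2 ≤ iterate (tiltedData n) η t 1 := by
  have H := marginCertificate_tiltedData hn
  have h0 := fun t => (hadm.normStep_pos hn t).le
  filter_upwards [(hadm.tendsto_totalStep hn H.norm_le).eventually_ge_atTop (25 * Real.log n)]
    with t ht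
  have h1 := H.mul_totalStep_le_inner h0 t
  rw [inner_axis] at h1
  obtain ⟨h2, h3 | h3⟩ := tilted_dichotomy hn h0 t
  · linarith [Real.log_pos one_lt_two]
  · exact h3

lemma le_directionError_tilted (hn : 0 < n) (hadm : AdmissibleSteps (tiltedData n) η) :
    ∀ᶠ t in atTop, (Real.log n - Real.log 2) / ‖iterate (tiltedData n) η t‖ ≤
      directionError (tiltedData n) η !₂[1, 0] t := by
  filter_upwards [eventually_le_tilted hn hadm] with t ht
  calc (Real.log n - Real.log 2) / ‖iterate (tiltedData n) η t‖
      ≤ iterate (tiltedData n) η t 1 / ‖iterate (tiltedData n) η t‖ := by gcongr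
    _ = ((‖iterate (tiltedData n) η t‖⁻¹ • iterate (tiltedData n) η t) - !₂[1, 0] : Vec 2) 1 := by
        simp [div_eq_inv_mul]
    _ ≤ _ := (le_abs_self _).trans (PiLp.norm_apply_le (_ : Vec 2) 1)

end TiltedIterates

end ImplicitBias

end

theorem mainTheorem5 :
    -- upper bounds
    (∃ C : ℝ → ℝ≥0∞ → ℝ → ℝ,
      ∀ (n d : ℕ), 0 < n →
      ∀ (P : Measure (Fin n → ImplicitBias.Vec d)) [IsProbabilityMeasure P],
        P ≪ (volume : Measure (Fin n → ImplicitBias.Vec d)) →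
      ∀ᵐ Z ∂P, (∀ i, ‖Z i‖ ≤ 1) → ImplicitBias.Separable Z →
        ∃ ubar vbar : ImplicitBias.Vec d,
          (∀ u, ImplicitBias.IsMaxMarginDirection Z u ↔ u = ubar) ∧
          (∀ v, ImplicitBias.IsOrthMinimizer Z ubar v ↔ v = vbar) ∧
          (∀ η : ℕ → ℝ, ImplicitBias.AdmissibleSteps Z η → ∀ t : ℕ, 1 ≤ t →
            ImplicitBias.directionError Z η ubar t ≤
              C (ImplicitBias.margin Z ubar) (ImplicitBias.supportGap Z ubar) ‖vbar‖ *
                Real.log n / ∑ j ∈ Finset.range t, ImplicitBias.normStep Z η j) ∧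
          (∀ η : ℕ → ℝ, (∀ j, ImplicitBias.normStep Z η j = 1) → ∀ t : ℕ, 1 ≤ t →
            ImplicitBias.directionError Z η ubar t ≤
              C (ImplicitBias.margin Z ubar) (ImplicitBias.supportGap Z ubar) ‖vbar‖ *
                Real.log n / t) ∧
          (∀ η : ℕ → ℝ, (∀ j, η j = 1) → ∀ t : ℕ, 2 ≤ t →
            ImplicitBias.directionError Z η ubar t ≤
              C (ImplicitBias.margin Z ubar) (ImplicitBias.supportGap Z ubar) ‖vbar‖ *
                Real.log n / Real.log t)) ∧
    -- lower bounds
    (∃ a b : ℝ, 0 < a ∧ 0 < b ∧ ∀ n : ℕ, 0 < n →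
      ∃ (Z : Fin n → ImplicitBias.Vec 2) (ubar : ImplicitBias.Vec 2),
        (∀ i, ‖Z i‖ ≤ 1) ∧ ImplicitBias.Separable Z ∧
        (∀ u, ImplicitBias.IsMaxMarginDirection Z u ↔ u = ubar) ∧
        (∀ η : ℕ → ℝ, ImplicitBias.AdmissibleSteps Z η → ∀ᶠ t : ℕ in atTop,
          (Real.log n - Real.log 2) / ‖ImplicitBias.iterate Z η t‖ ≤
            ImplicitBias.directionError Z η ubar t) ∧
        (∀ η : ℕ → ℝ, (∀ j, ImplicitBias.normStep Z η j = 1) → ∀ᶠ t : ℕ in atTop,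
          (Real.log n - Real.log 2) / ‖ImplicitBias.iterate Z η t‖ ≤
            ImplicitBias.directionError Z η ubar t ∧
          (Real.log n - Real.log 2) / t ≤ ImplicitBias.directionError Z η ubar t) ∧
        (∀ η : ℕ → ℝ, (∀ j, η j = 1) → ∀ᶠ t : ℕ in atTop,
          (Real.log n - Real.log 2) / ‖ImplicitBias.iterate Z η t‖ ≤
            ImplicitBias.directionError Z η ubar t ∧
          a * Real.log t ≤ ‖ImplicitBias.iterate Z η t‖ ∧
          ‖ImplicitBias.iterate Z η t‖ ≤ b * Real.log t)) := by
  open ImplicitBias in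
  constructor
  · refine ⟨fun γ g r => 2 * biasConst γ (gapWidth g) r / γ, fun n d hn P _ hP => ?_⟩
    filter_upwards [hP.ae_le (ae_dual_weights_pos n d)] with Z hZ hnorm hsep
    obtain ⟨u, γ, H⟩ := exists_marginCertificate hn hnorm hsep
    obtain ⟨v, hv, HS⟩ := H.exists_supportCertificate (hZ u γ H)
    have key : ∀ η, AdmissibleSteps Z η → ∀ t : ℕ, 1 ≤ t → directionError Z η u t ≤
        2 * biasConst (margin Z u) (gapWidth (supportGap Z u)) ‖v‖ / margin Z u * Real.log n /
          totalStep Z η t := fun η hη t ht => by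
      rw [H.margin_eq]
      exact HS.directionError_le (hη.normStep_pos hn) hη.le_one ht
    refine ⟨u, v, H.isMaxMarginDirection_iff, hv, key, fun η hη t ht => ?_, fun η hη t ht => ?_⟩
    · have h1 := key η (admissibleSteps_of_normStep_eq_one hn hnorm hη) t ht
      rwa [totalStep_of_normStep_eq_one hη] at h1
    · have ht' : 1 ≤ t := by omega
      have htr : (2 : ℝ) ≤ t := by exact_mod_cast ht
      have hlog0 : 0 < Real.log t := Real.log_pos (by linarith)
      have hlog : Real.log t ≤ totalStep Z η t :=
        (Real.log_le_log (by linarith) (by linarith)).trans (log_le_totalStep hn hnorm hη t)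
      have h1 := key η (admissibleSteps_of_step_eq_one hn hnorm hη) t ht'
      have h2 : 0 ≤ 2 * biasConst (margin Z u) (gapWidth (supportGap Z u)) ‖v‖ / margin Z u *
          Real.log n := by
        have h3 := mul_le_mul_of_nonneg_right h1 (hlog0.trans_le hlog).le
        rw [div_mul_cancel₀ _ (hlog0.trans_le hlog).ne'] at h3
        exact (mul_nonneg (norm_nonneg _) (hlog0.trans_le hlog).le).trans h3
      exact h1.trans (div_le_div_of_nonneg_left h2 hlog0 hlog)
  · refine ⟨1 / 5, 75, by norm_num, by norm_num, fun n hn => ?_⟩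
    have H := marginCertificate_tiltedData hn
    refine ⟨tiltedData n, !₂[1, 0], H.norm_le, ⟨!₂[1, 0], fun i => ?_⟩,
      H.isMaxMarginDirection_iff, fun η hη => le_directionError_tilted hn hη, fun η hη => ?_,
      fun η hη => ?_⟩
    · rw [inner_neg_right]
      linarith [H.margin_le i]
    · have hadm := admissibleSteps_of_normStep_eq_one hn H.norm_le hη
      filter_upwards [le_directionError_tilted hn hadm, eventually_ge_atTop 1] with t h1 ht
      refine ⟨h1, ?_⟩
      rcases le_total (Real.log n - Real.log 2) 0 with hneg | hpos
      · exact (div_nonpos_of_nonpos_of_nonneg hneg (Nat.cast_nonneg t)).trans (norm_nonneg _)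
      · refine le_trans (div_le_div_of_nonneg_left hpos ?_ ?_) h1
        · have h2 := H.mul_totalStep_le_inner (fun t => (hadm.normStep_pos hn t).le) t
          have h3 := real_inner_le_norm (iterate (tiltedData n) η t) !₂[1, 0]
          rw [H.unit, mul_one] at h3
          rw [totalStep_of_normStep_eq_one hη] at h2
          have : (1 : ℝ) ≤ t := by exact_mod_cast ht
          linarith
        · rw [← totalStep_of_normStep_eq_one hη]
          exact norm_iterate_le hn H.norm_le (fun t => (hadm.normStep_pos hn t).le) t
    · have hadm := admissibleSteps_of_step_eq_one hn H.norm_le hη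
      have h0 := fun t => (hadm.normStep_pos hn t).le
      filter_upwards [le_directionError_tilted hn hadm, eventually_ge_atTop 2] with t h1 ht
      have htr : (2 : ℝ) ≤ t := by exact_mod_cast ht
      refine ⟨h1, ?_, ?_⟩
      · have h2 := H.mul_totalStep_le_inner h0 t
        have h3 := real_inner_le_norm (iterate (tiltedData n) η t) !₂[1, 0]
        rw [H.unit, mul_one] at h3
        have h4 := log_le_totalStep hn H.norm_le hη t
        have h5 : Real.log t ≤ Real.log (t + 1) := Real.log_le_log (by linarith) (by linarith)
        linarith
      · have h2 := norm_iterate_le hn H.norm_le h0 t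
        have h3 := H.totalStep_le_log hη t
        -- For `t ≥ 2` one has `1 + 2 t ≤ t ^ 3`.
        have h4 : Real.log (1 + 2 * t) ≤ 3 * Real.log t := by
          rw [← Real.log_rpow (by linarith)]
          refine Real.log_le_log (by linarith) ?_
          norm_cast
          nlinarith [Nat.pow_le_pow_left ht 2]
        linarith
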